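/- Let $K$ be a compact connected Lie group with Lie algebra $\mathfrak k$, and let $G$ be its complexification: a connected complex Lie group containing $K$, with Lie algebra $\mathfrak g=\mathfrak k\oplus\mathbf i\mathfrak k$, that has a faithful finite-dimensional holomorphic representation whose restriction to $K$ is unitary. Let $F$ be a (finite-dimensional, Hausdorff) Kähler manifold with complex structure $I$ and Kähler form $\omega$, with Kähler metric $\omega(\cdot,I\cdot)$. Let $K$ act on $F$ preserving $\omega$, and suppose that this action extends to a holomorphic action $G\times F\to F$ of $G$. For $s\in\mathfrak k$ let $\mathcal X_s$ be the vector field on $F$ generated by $s$. Let $\mu:F\to\mathfrak k^*$ be a moment map: it is smooth, the functions $\mu_s=\langle\mu,s\rangle$ satisfy $d\mu_s=\omega(\mathcal X_s,\cdot)$ for all $s\in\mathfrak k$, and $\langle\mu(hx),\operatorname{Ad}(h)s\rangle=\langle\mu(x),s\rangle$ for all $h\in K$, $x\in F$, $s\in\mathfrak k$. For $x\in F$, $s\in\mathfrak k$ and $t\in\mathbb R$ put $\lambda_t(x;s)=\mu_s(e^{\mathbf i ts}x)$, and let the maximal weight be $\lambda(x;s)=\lim_{t\to\infty}\lambda_t(x;s)$.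 Call $x$ analytically stable if $\lambda(x;s)>0$ for every nonzero $s\in\mathfrak k$. Then for every $x\in F$: (a) there is at most one $K$-orbit inside the orbit $Gx$ on which $\mu$ vanishes; (b) for every $s\in\mathfrak k$ the limit $\lambda(x;s)$ exists in the extended real line; (c) $x$ is analytically stable if and only if (1) the stabiliser $G_x$ of $x$ in $G$ is finite and (2) there is a $K$-orbit inside $Gx$ on which $\mu$ vanishes. -/

import Mathlib

open scoped Manifold ContDiff Topology

namespace KempfNess

noncomputable section

/-! ### Lie groups: exponential map and complexification -/

/-- The exponential map of a Lie group: `lieExp v = γ 1`, where `γ : ℝ → G` is the one-parameter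
subgroup with `γ'(0) = v`. -/
def lieExp {E : Type*} [NormedAddCommGroup E] [NormedSpace ℝ E]
    {G : Type*} [Group G] [TopologicalSpace G] [ChartedSpace E G]
    (v : TangentSpace 𝓘(ℝ, E) (1 : G)) : G :=
  open Classical in
  if h : ∃ γ : ℝ → G, γ 0 = 1 ∧ (∀ s t, γ (s + t) = γ s * γ t) ∧
      MDifferentiableAt 𝓘(ℝ, ℝ) 𝓘(ℝ, E) γ 0 ∧
      (mfderiv 𝓘(ℝ, ℝ) 𝓘(ℝ, E) γ 0 (1 : ℝ) : E) = v
  then h.choose 1 else 1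

/-- Multiplication by `𝐢` on the real tangent space of a complex manifold: the almost complex
structure defined by the complex structure. -/
def complexStructure {E : Type*} [NormedAddCommGroup E] [NormedSpace ℂ E]
    {M : Type*} [TopologicalSpace M] [ChartedSpace E M] (x : M) :
    TangentSpace 𝓘(ℝ, E) x →L[ℝ] TangentSpace 𝓘(ℝ, E) x :=
  (Complex.I • ContinuousLinearMap.id ℝ E : E →L[ℝ] E)

/-- The map `𝔨 → 𝔤` of Lie algebras induced by a homomorphism `ι : K → G`, that is, the
differential of `ι` at `1`. -/
def lieMap {EK : Type*} [NormedAddCommGroup EK] [NormedSpace ℝ EK]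
    {K : Type*} [Group K] [TopologicalSpace K] [ChartedSpace EK K]
    {EG : Type*} [NormedAddCommGroup EG] [NormedSpace ℝ EG]
    {G : Type*} [Group G] [TopologicalSpace G] [ChartedSpace EG G]
    (ι : K →* G) (s : TangentSpace 𝓘(ℝ, EK) (1 : K)) : TangentSpace 𝓘(ℝ, EG) (1 : G) :=
  (mfderiv 𝓘(ℝ, EK) 𝓘(ℝ, EG) (fun k : K => ι k) 1 s : EG)

/-- `ι : K → G` exhibits the complex Lie group `G` as the complexification of the compact connected
Lie group `K`: `G` is a connected complex linear group containing `K`, with Lie algebra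
`𝔤 = 𝔨 ⊕ 𝐢𝔨 = 𝔨 ⊗ ℂ`. Linearity is expressed by a faithful holomorphic representation `ρ` of `G`
on a finite-dimensional Hermitian space on which `K` acts by unitary maps. (Without a faithful
representation, `ℂ / (ℤ + 𝐢ℤ)` would be a complexification of the circle.) -/
structure IsComplexification {EK : Type*} [NormedAddCommGroup EK] [NormedSpace ℝ EK]
    {K : Type*} [Group K] [TopologicalSpace K] [ChartedSpace EK K]
    {EG : Type*} [NormedAddCommGroup EG] [NormedSpace ℂ EG]
    {G : Type*} [Group G] [TopologicalSpace G] [ChartedSpace EG G] (ι : K →* G) : Prop where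
  smooth : ContMDiff 𝓘(ℝ, EK) 𝓘(ℝ, EG) ∞ (fun k : K => ι k)
  injective : Function.Injective ι
  connected : ConnectedSpace G
  lieAlgebra : Function.Bijective
    (fun p : TangentSpace 𝓘(ℝ, EK) (1 : K) × TangentSpace 𝓘(ℝ, EK) (1 : K) =>
      (lieMap ι p.1 + complexStructure (1 : G) (lieMap ι p.2) : TangentSpace 𝓘(ℝ, EG) (1 : G)))
  linear : ∃ (n : ℕ) (ρ : G →* (EuclideanSpace ℂ (Fin n) →L[ℂ] EuclideanSpace ℂ (Fin n))),
    ContMDiff 𝓘(ℂ, EG) 𝓘(ℂ, EuclideanSpace ℂ (Fin n) →L[ℂ] EuclideanSpace ℂ (Fin n)) ω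
      (fun g : G => ρ g) ∧
    Function.Injective ρ ∧ ∀ (k : K) (w : EuclideanSpace ℂ (Fin n)), ‖ρ (ι k) w‖ = ‖w‖

/-- `Ad(h) : 𝔨 → 𝔨`, the differential at `1` of `k ↦ h k h⁻¹`. -/
def Ad {EK : Type*} [NormedAddCommGroup EK] [NormedSpace ℝ EK]
    {K : Type*} [Group K] [TopologicalSpace K] [ChartedSpace EK K]
    (h : K) (s : TangentSpace 𝓘(ℝ, EK) (1 : K)) : TangentSpace 𝓘(ℝ, EK) (1 : K) :=
  (mfderiv 𝓘(ℝ, EK) 𝓘(ℝ, EK) (fun k : K => h * k * h⁻¹) 1 s : EK)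

/-! ### Kähler manifolds -/

/-- A (real) differential 2-form on a manifold, without regularity. -/
abbrev TwoForm (E : Type*) [NormedAddCommGroup E] [NormedSpace ℝ E]
    (M : Type*) [TopologicalSpace M] [ChartedSpace E M] : Type _ :=
  (x : M) → TangentSpace 𝓘(ℝ, E) x [⋀^Fin 2]→L[ℝ] ℝ

/-- The expression of the 2-form `Ω` in the chart at `x₀` (its pullback under the inverse chart). -/
def TwoForm.inChart {E : Type*} [NormedAddCommGroup E] [NormedSpace ℝ E]
    {M : Type*} [TopologicalSpace M] [ChartedSpace E M] (Ω : TwoForm E M) (x₀ : M) (y : E) :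
    E [⋀^Fin 2]→L[ℝ] ℝ :=
  (Ω ((chartAt E x₀).symm y)).compContinuousLinearMap
    (mfderiv 𝓘(ℝ, E) 𝓘(ℝ, E) (chartAt E x₀).symm y)

/-- `Ω` is a Kähler form on the complex manifold `M`: it is smooth and closed, and
`g(u, v) = Ω(u, Iv)` is a Riemannian metric. -/
structure IsKahlerForm {E : Type*} [NormedAddCommGroup E] [NormedSpace ℂ E]
    {M : Type*} [TopologicalSpace M] [ChartedSpace E M] (Ω : TwoForm E M) : Prop where
  smooth : ∀ x₀ : M, ContDiffOn ℝ ∞ (Ω.inChart x₀) (chartAt E x₀).target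
  closed : ∀ x₀ : M, ∀ y ∈ (chartAt E x₀).target, extDeriv (Ω.inChart x₀) y = 0
  symm : ∀ (x : M) (u v : TangentSpace 𝓘(ℝ, E) x),
    Ω x ![u, complexStructure x v] = Ω x ![v, complexStructure x u]
  pos : ∀ (x : M) (u : TangentSpace 𝓘(ℝ, E) x), u ≠ 0 → 0 < Ω x ![u, complexStructure x u]

/-! ### Group actions, moment maps and maximal weights -/

/-- The 2-form `Ω` is invariant under the action of `K` on `M`. -/
def TwoForm.IsInvariant (K : Type*) {E : Type*} [NormedAddCommGroup E] [NormedSpace ℝ E]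
    {M : Type*} [TopologicalSpace M] [ChartedSpace E M] [SMul K M] (Ω : TwoForm E M) : Prop :=
  ∀ (k : K) (x : M), (Ω (k • x)).compContinuousLinearMap
    (mfderiv 𝓘(ℝ, E) 𝓘(ℝ, E) (fun y : M => k • y) x) = Ω x

/-- The vector field `𝒳ₛ` on `M` generated by the infinitesimal action of `s ∈ 𝔨`:
`𝒳ₛ(x)` is the image of `s` under the differential at `1` of `k ↦ k x`. -/
def infinitesimalAction {EK : Type*} [NormedAddCommGroup EK] [NormedSpace ℝ EK]
    {K : Type*} [Group K] [TopologicalSpace K] [ChartedSpace EK K]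
    {E : Type*} [NormedAddCommGroup E] [NormedSpace ℝ E]
    {M : Type*} [TopologicalSpace M] [ChartedSpace E M] [MulAction K M]
    (s : TangentSpace 𝓘(ℝ, EK) (1 : K)) (x : M) : TangentSpace 𝓘(ℝ, E) x :=
  (mfderiv 𝓘(ℝ, EK) 𝓘(ℝ, E) (fun k : K => k • x) 1 s : E)

/-- `μ : M → 𝔨*` is a moment map for the action of `K` on `M` with respect to `Ω`:
each `μₛ = ⟨μ, s⟩` is smooth with `dμₛ = Ω(𝒳ₛ, ·)`, and `μ` is equivariant for the coadjoint
action, `⟨μ(hx), Ad(h)s⟩ = ⟨μ(x), s⟩`. -/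
structure IsMomentMap {EK : Type*} [NormedAddCommGroup EK] [NormedSpace ℝ EK]
    {K : Type*} [Group K] [TopologicalSpace K] [ChartedSpace EK K]
    {E : Type*} [NormedAddCommGroup E] [NormedSpace ℝ E]
    {M : Type*} [TopologicalSpace M] [ChartedSpace E M] [MulAction K M]
    (Ω : TwoForm E M) (μ : M → Module.Dual ℝ (TangentSpace 𝓘(ℝ, EK) (1 : K))) : Prop where
  smooth : ∀ s, ContMDiff 𝓘(ℝ, E) 𝓘(ℝ, ℝ) ∞ (fun x : M => μ x s)
  hamiltonian : ∀ s (x : M) (v : TangentSpace 𝓘(ℝ, E) x),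
    (mfderiv 𝓘(ℝ, E) 𝓘(ℝ, ℝ) (fun y : M => μ y s) x v : ℝ) = Ω x ![infinitesimalAction s x, v]
  equivariant : ∀ (h : K) (x : M) s, μ (h • x) (Ad h s) = μ x s

section Weights

variable {EK : Type*} [NormedAddCommGroup EK] [NormedSpace ℝ EK]
  {K : Type*} [Group K] [TopologicalSpace K] [ChartedSpace EK K]
  (EG : Type*) [NormedAddCommGroup EG] [NormedSpace ℂ EG]
  {G : Type*} [Group G] [TopologicalSpace G] [ChartedSpace EG G]
  {M : Type*} [MulAction G M]

/-- `λₜ(x; s) = μₛ(e^{𝐢ts} x)`. -/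
def weight (ι : K →* G) (μ : M → Module.Dual ℝ (TangentSpace 𝓘(ℝ, EK) (1 : K)))
    (x : M) (s : TangentSpace 𝓘(ℝ, EK) (1 : K)) (t : ℝ) : ℝ :=
  μ (lieExp (E := EG) (t • complexStructure (1 : G) (lieMap ι s)) • x) s

/-- The maximal weight `λ(x; s) = lim_{t → ∞} λₜ(x; s)`, an extended real number. -/
def maximalWeight (ι : K →* G) (μ : M → Module.Dual ℝ (TangentSpace 𝓘(ℝ, EK) (1 : K)))
    (x : M) (s : TangentSpace 𝓘(ℝ, EK) (1 : K)) : EReal :=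
  Filter.limUnder Filter.atTop (fun t : ℝ => (weight EG ι μ x s t : EReal))

/-- `x` is analytically stable: `λ(x; s) > 0` for every nonzero `s ∈ 𝔨`. -/
def AnalyticallyStable (ι : K →* G) (μ : M → Module.Dual ℝ (TangentSpace 𝓘(ℝ, EK) (1 : K)))
    (x : M) : Prop :=
  ∀ s : TangentSpace 𝓘(ℝ, EK) (1 : K), s ≠ 0 → 0 < maximalWeight EG ι μ x s

end Weights

end

end KempfNess

/-!
The theorem is a version of the Kempf-Ness theorem for Kähler actions of complexified groups.

Everything takes place along the polar decomposition `G = K exp (𝐢𝔨)` (`PolarData.exists_polar`).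
It is proved in the faithful representation `ρ`, whose values lie in a C⋆-algebra: the set
`K exp (𝐢𝔨)` is closed, since polar coordinates are bounded by the norms of `ρ g` and `ρ g⁻¹`, and
it is open, since the polar map is an immersion (`eq_zero_of_skew_mul_exp_add_dexp`); `G` is
connected.

The weight `λₜ(x; s)` is nondecreasing in `t`, its derivative being the squared length of `𝒳ₛ`
(`MomentData.monotone_w`). So its limit exists and equals its supremum, and analytic stability
means that for every `s ≠ 0` some weight `λₜ(x; s)` is positive (`MomentData.Positive`). If `μ`
vanishes at `y` and at `k exp (𝐢 s) y`, then the weight of `y` along `s` vanishes at `t = 0` and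
`t = 1`, hence is constant between, so that `𝒳ₛ` vanishes at `y` and `exp (𝐢 s)` fixes `y`
(`MomentData.E_smul_of_m_eq_zero`). This is the uniqueness of the zero orbit. It also shows that the
stabiliser of an analytically stable zero lies in `K`, where it is discrete and closed, hence finite
(`MomentData.Positive.finite_stabilizer`); conversely, a zero with finite stabiliser has positive
weights (`MomentData.positive_of_finite_stabilizer`).

For the existence of zeros, the moment map defines a 1-form on `𝔨`, the pullback of
`v ↦ ⟨μ (g x), Im v⟩` by `s ↦ exp (𝐢 s)`. It is closed by the Maurer-Cartan equation
(`PolarData.fderiv_B_sub`) and the equivariance of `μ` (`MomentData.fderiv_form_symm`), so the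
Poincaré lemma gives a potential `Ψ`, the Kempf-Ness function of `x`. Along rays its derivative is
the weight. If the weights are eventually positive, then `Ψ` grows at least linearly and attains its
minimum (`MomentData.Positive.exists_linear_growth`), and critical points of `Ψ` are zeros of `μ`
(`MomentData.Positive.exists_zero`).

It remains to see that analytic stability is a property of the orbit `G x`
(`MomentData.Positive.smul`). Suppose that all weights of `g y` along `s ≠ 0` were at most `0`. The
Kempf-Ness function of `y`, evaluated at the polar coordinate of `exp (𝐢 t s) g`, has the weight of
`g y` along `s` as derivative, so it would be nonincreasing in `t`; but the polar coordinate is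
unbounded for `t ≥ 0`, and the function grows linearly.

The passage from manifolds to this setting consists of two parts. `LinearModel` collects `ρ` and the
differentials at `1` and provides the exponential map of `G` and its smoothness;
`LinearModel.momentData` derives from the Kähler form and the moment map the derivative of `μ` along
the curves `t ↦ exp (𝐢 (s + t q)) y`.
-/

namespace KempfNess

open NormedSpace

/-! ### The exponential map of a C⋆-algebra -/

section CStar

variable {A : Type*} [CStarAlgebra A]

/-- The differential of the exponential map of `A` at `x`. -/
noncomputable def dexp (x : A) : A →L[ℝ] A := fderiv ℝ (exp : A → A) x

lemma contDiff_exp_cstar : ContDiff ℝ ω (exp : A → A) := by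
  rw [← contDiffOn_univ]
  exact AnalyticOn.contDiffOn (fun x _ => (exp_analytic (𝕂 := ℝ) x).analyticWithinAt)
    uniqueDiffOn_univ

lemma hasStrictFDerivAt_exp (x : A) : HasStrictFDerivAt (exp : A → A) (dexp x) x :=
  contDiff_exp_cstar.contDiffAt.hasStrictFDerivAt (by simp)

lemma contDiff_dexp : ContDiff ℝ ω (dexp : A → A →L[ℝ] A) :=
  contDiff_exp_cstar.fderiv_right (m := ω) (by simp)

lemma exp_add_comm' {x y : A} (h : Commute x y) : exp (x + y) = exp x * exp y := by
  let +nondep : NormedAlgebra ℚ A := .restrictScalars ℚ ℂ A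
  exact exp_add_of_commute h

@[simp] lemma exp_mul_exp_neg (x : A) : exp x * exp (-x) = 1 := by
  rw [← exp_add_comm' (Commute.neg_right rfl)]; simp

@[simp] lemma exp_neg_mul_exp (x : A) : exp (-x) * exp x = 1 := by
  rw [← exp_add_comm' (Commute.neg_left rfl)]; simp

lemma exp_two_smul (x : A) : exp ((2 : ℝ) • x) = exp x * exp x := by
  rw [two_smul, exp_add_comm' rfl]

lemma hasDerivAt_exp_line (x h : A) : HasDerivAt (fun t : ℝ => exp (x + t • h)) (dexp x h) 0 := by
  have h1 : HasDerivAt (fun t : ℝ => x + t • h) h 0 := by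
    simpa using ((hasDerivAt_id (0 : ℝ)).smul_const h).const_add x
  have h2 : HasFDerivAt (exp : A → A) (dexp x) (x + (0 : ℝ) • h) := by
    simpa using (hasStrictFDerivAt_exp x).hasFDerivAt
  exact h2.comp_hasDerivAt (0 : ℝ) h1

lemma hasDerivAt_exp_smul (x : A) (t : ℝ) :
    HasDerivAt (fun t : ℝ => exp (t • x)) (x * exp (t • x)) t := by
  have h := hasDerivAt_exp_smul_const (𝕂 := ℝ) x t
  have hc : Commute x (exp (t • x)) := ((Commute.refl x).smul_right t).exp_right
  rwa [hc.eq]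

lemma dexp_of_commute {x h : A} (hc : Commute x h) : dexp x h = h * exp x := by
  have h1 := hasDerivAt_exp_line x h
  have h2 : HasDerivAt (fun t : ℝ => exp (t • h) * exp x) (h * exp ((0 : ℝ) • h) * exp x) 0 :=
    (hasDerivAt_exp_smul h 0).mul_const _
  have h3 : (fun t : ℝ => exp (x + t • h)) = fun t : ℝ => exp (t • h) * exp x := by
    funext t
    rw [add_comm, exp_add_comm' (hc.symm.smul_left t)]
  rw [h3] at h1
  simpa using h1.unique h2

lemma dexp_zero (h : A) : dexp 0 h = h := by
  rw [dexp_of_commute (Commute.zero_left h)]; simp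

/-- Differentiate `x exp x = exp x x`. -/
lemma mul_dexp_sub (x h : A) : h * exp x + x * dexp x h = dexp x h * x + exp x * h := by
  have h1 : HasDerivAt (fun t : ℝ => x + t • h) h 0 := by
    simpa using ((hasDerivAt_id (0 : ℝ)).smul_const h).const_add x
  have h2 := hasDerivAt_exp_line x h
  have h3 := h1.mul h2
  have h4 := h2.mul h1
  have h5 : ((fun t : ℝ => x + t • h) * fun t : ℝ => exp (x + t • h))
      = (fun t : ℝ => exp (x + t • h)) * fun t : ℝ => x + t • h := by
    funext t
    exact ((Commute.refl (x + t • h)).exp_right).eq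
  rw [h5] at h3
  simpa using h3.unique h4

lemma commute_of_commute_exp {S R : A} (hS : IsSelfAdjoint S) (h : Commute (exp S) R) :
    Commute S R := by
  have := h.cfc_real Real.log
  have h2 : cfc Real.log (exp S) = S := CFC.log_exp S
  rwa [h2] at this

lemma eq_zero_of_mul_exp_eq_zero {S R : A} (h : R * exp S = 0) : R = 0 := by
  have : R * exp S * exp (-S) = 0 := by rw [h, zero_mul]
  simpa [mul_assoc] using this

/-- The exponential map is an immersion at self-adjoint elements: a kernel vector of its
differential at `S` commutes with `exp S`, hence with `S = log (exp S)`. -/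
lemma eq_zero_of_dexp_eq_zero {S R : A} (hS : IsSelfAdjoint S) (h : dexp S R = 0) : R = 0 := by
  have h1 := mul_dexp_sub S R
  rw [h] at h1
  simp only [mul_zero, add_zero, zero_mul, zero_add] at h1
  have h2 : Commute S R := commute_of_commute_exp hS h1.symm
  rw [dexp_of_commute h2] at h
  exact eq_zero_of_mul_exp_eq_zero h

lemma dexp_two_smul (S R : A) :
    dexp ((2 : ℝ) • S) ((2 : ℝ) • R) = dexp S R * exp S + exp S * dexp S R := by
  have h1 := hasDerivAt_exp_line ((2 : ℝ) • S) ((2 : ℝ) • R)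
  have h2 := (hasDerivAt_exp_line S R).mul (hasDerivAt_exp_line S R)
  have h3 : (fun t : ℝ => exp ((2 : ℝ) • S + t • (2 : ℝ) • R))
      = (fun t : ℝ => exp (S + t • R)) * fun t : ℝ => exp (S + t • R) := by
    funext t
    rw [smul_comm t, ← smul_add, exp_two_smul]
    rfl
  rw [h3] at h1
  simpa using h1.unique h2

lemma star_dexp {S R : A} (hS : IsSelfAdjoint S) (hR : IsSelfAdjoint R) :
    star (dexp S R) = dexp S R := by
  have h1 := hasDerivAt_exp_line S R
  have h2 := h1.star
  have h3 : (fun t : ℝ => star (exp (S + t • R))) = fun t : ℝ => exp (S + t • R) := by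
    funext t
    rw [star_exp]
    simp [hS.star_eq, hR.star_eq]
  rw [h3] at h2
  exact h2.unique h1

/-- The infinitesimal polar decomposition: the map `(u, S) ↦ u exp S` on unitary and self-adjoint
elements is an immersion. Taking adjoints, `dexp S R = -a exp S = exp S a`, so that the differential
of the exponential map at `2 S` kills `2 R`. -/
lemma eq_zero_of_skew_mul_exp_add_dexp {a S R : A} (ha : star a = -a) (hS : IsSelfAdjoint S)
    (hR : IsSelfAdjoint R) (h : a * exp S + dexp S R = 0) : R = 0 ∧ a = 0 := by
  have h1 : dexp S R = -(a * exp S) := (neg_eq_of_add_eq_zero_right h).symm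
  have hE : star (exp S) = exp S := by rw [star_exp, hS.star_eq]
  have h2 : dexp S R = exp S * a := by
    rw [← star_dexp hS hR, h1]
    simp [ha, hE]
  have h3 : dexp ((2 : ℝ) • S) ((2 : ℝ) • R) = 0 := by
    rw [dexp_two_smul]
    nth_rewrite 1 [h2]
    rw [h1]
    noncomm_ring
  have hR0 : R = 0 := by
    have := eq_zero_of_dexp_eq_zero (by simp [isSelfAdjoint_iff, hS.star_eq]) h3
    simpa using this
  refine ⟨hR0, ?_⟩
  rw [hR0] at h
  simp only [map_zero, add_zero] at h
  exact eq_zero_of_mul_exp_eq_zero h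

lemma exp_injOn_selfAdjoint {S S' : A} (hS : IsSelfAdjoint S) (hS' : IsSelfAdjoint S')
    (h : exp S = exp S') : S = S' := by
  rw [← CFC.log_exp S, ← CFC.log_exp S', h]

/-- Uniqueness of the polar decomposition. -/
lemma polar_unique {u u' S S' : A} (hu : star u * u = 1) (hu' : star u' * u' = 1)
    (hS : IsSelfAdjoint S) (hS' : IsSelfAdjoint S') (h : u * exp S = u' * exp S') : S = S' := by
  have key : ∀ {v R : A}, star v * v = 1 → IsSelfAdjoint R →
      star (v * exp R) * (v * exp R) = exp ((2 : ℝ) • R) := by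
    intro v R hv hR
    rw [star_mul, star_exp, hR.star_eq, exp_two_smul, mul_assoc, ← mul_assoc (star v), hv, one_mul]
  have h2 := key hu hS
  rw [h, key hu' hS'] at h2
  have := exp_injOn_selfAdjoint (S := (2 : ℝ) • S') (S' := (2 : ℝ) • S)
    (by simp [isSelfAdjoint_iff, hS'.star_eq]) (by simp [isSelfAdjoint_iff, hS.star_eq]) h2
  exact (smul_right_injective A (two_ne_zero (α := ℝ)) this).symm

/-- The spectral bound `x ≤ exp x` for `S` and `-S`. -/
lemma norm_le_of_norm_exp_le {S : A} (hS : IsSelfAdjoint S) {C : ℝ} (hC : 0 ≤ C)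
    (h1 : ‖exp S‖ ≤ C) (h2 : ‖exp (-S)‖ ≤ C) : ‖S‖ ≤ C := by
  have hp : ∀ R : A, IsSelfAdjoint R → ‖exp R‖ ≤ C → ∀ x ∈ spectrum ℝ R, x ≤ C := by
    intro R hR hRC x hx
    rw [← CFC.real_exp_eq_normedSpace_exp hR, norm_cfc_le_iff Real.exp R hC] at hRC
    have := hRC x hx
    rw [Real.norm_eq_abs, abs_of_pos (Real.exp_pos x)] at this
    linarith [Real.add_one_le_exp x]
  rw [← cfc_id ℝ S, norm_cfc_le_iff id S hC]
  intro x hx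
  rw [Real.norm_eq_abs, abs_le]
  refine ⟨?_, hp S hS h1 x hx⟩
  have := hp (-S) hS.neg h2 (-x) (by rw [← spectrum.neg_eq]; simpa using hx)
  simp only [id]
  linarith

/-- A homomorphism `ℝ → A` that is differentiable at `0` is an exponential. -/
lemma eq_exp_smul_of_hasDerivAt {γ : ℝ → A} {x : A} (h0 : γ 0 = 1)
    (hadd : ∀ s t, γ (s + t) = γ s * γ t) (hd : HasDerivAt γ x 0) (t : ℝ) :
    γ t = exp (t • x) := by
  have hγ : ∀ t, HasDerivAt γ (γ t * x) t := by
    intro t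
    have h1 : HasDerivAt (fun s => γ t * γ (s - t)) (γ t * x) t := by
      have : HasDerivAt γ x (t - t) := by simpa using hd
      simpa using (this.comp_sub_const t t).const_mul (γ t)
    refine h1.congr_of_eventuallyEq (Filter.Eventually.of_forall fun s => ?_)
    simp only [← hadd]
    congr 1; ring
  have hE : ∀ t : ℝ, HasDerivAt (fun t : ℝ => exp (t • -x)) (-x * exp (t • -x)) t :=
    hasDerivAt_exp_smul (-x)
  have hP : ∀ t, HasDerivAt (γ * fun t : ℝ => exp (t • -x)) 0 t := by
    intro t
    have := (hγ t).mul (hE t)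
    convert this using 1
    noncomm_ring
  have hc := is_const_of_deriv_eq_zero (fun t => (hP t).differentiableAt)
    (fun t => (hP t).deriv) t 0
  simp only [Pi.mul_apply, h0, zero_smul, exp_zero, mul_one] at hc
  have := congrArg (· * exp (t • x)) hc
  simpa [mul_assoc] using this

end CStar

/-! ### Polar decomposition -/

/-- The linear-algebraic data of a complexification `ι : K → G` on which the polar decomposition
rests: a faithful representation `ρ` of `G` in a C⋆-algebra, unitary on `K`, its differential
`T` restricted to `V = 𝔨`, and the exponential map `e (a, b) = exp (a + 𝐢 b)` of `G`. The map `π` is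
a left inverse of `(a, b) ↦ T a + 𝐢 T b`. The last fields say that `π ∘ ρ` is injective near `1`,
that `Ad` is conjugation in the representation, and that the logarithmic differential of
`s ↦ exp (𝐢 s)` takes its values in the image `T V + 𝐢 T V` of the Lie algebra of `G`. -/
structure PolarData (K G V A : Type*) [Group K] [TopologicalSpace K] [Group G] [TopologicalSpace G]
    [NormedAddCommGroup V] [NormedSpace ℝ V] [CStarAlgebra A] where
  ι : K →* G
  ρ : G →* A
  T : V →L[ℝ] A
  e : V × V → G
  π : A →L[ℝ] V × V
  Ad : K → V → V
  continuous_ι : Continuous ι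
  continuous_ρ : Continuous ρ
  continuous_e : Continuous e
  injective_ρ : Function.Injective ρ
  star_T : ∀ a, star (T a) = -T a
  π_apply : ∀ a b, π (T a + Complex.I • T b) = (a, b)
  ρ_e : ∀ a b, ρ (e (a, b)) = exp (T a + Complex.I • T b)
  star_ρ_ι : ∀ k, star (ρ (ι k)) * ρ (ι k) = 1
  exists_ι_eq : ∀ a, ∃ k, ι k = e (a, 0)
  exists_injOn : ∃ N ∈ 𝓝 (1 : G), Set.InjOn (fun g => π (ρ g)) N
  T_Ad : ∀ k s, T (Ad k s) = ρ (ι k) * T s * ρ (ι k⁻¹)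
  exists_dexp_eq : ∀ s r, ∃ a b, dexp (Complex.I • T s) (Complex.I • T r) *
    exp (-(Complex.I • T s)) = T a + Complex.I • T b

namespace PolarData

variable {K G V A : Type*} [Group K] [TopologicalSpace K] [Group G] [TopologicalSpace G]
  [NormedAddCommGroup V] [NormedSpace ℝ V] [CStarAlgebra A] (D : PolarData K G V A)

/-- The element `exp (𝐢 s)` of `G`. -/
def E (s : V) : G := D.e (0, s)

/-- The self-adjoint element `𝐢 T s` of `A`. -/
noncomputable def S : V →L[ℝ] A := Complex.I • D.T

/-- The logarithmic differential of `s ↦ exp (𝐢 s)` at `s` in the direction `r`. -/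
noncomputable def B (s : V) : V →L[ℝ] A :=
  ((ContinuousLinearMap.mul ℝ A).flip (exp (-D.S s))).comp ((dexp (D.S s)).comp D.S)

lemma S_apply (s : V) : D.S s = Complex.I • D.T s := rfl

lemma B_apply (s r : V) : D.B s r = dexp (D.S s) (D.S r) * exp (-D.S s) := rfl

lemma ρ_E (s : V) : D.ρ (D.E s) = exp (D.S s) := by simp [E, D.ρ_e, S_apply]

lemma continuous_E : Continuous D.E := D.continuous_e.comp (by fun_prop)

lemma isSelfAdjoint_S (s : V) : IsSelfAdjoint (D.S s) := by
  simp [isSelfAdjoint_iff, S_apply, D.star_T]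

lemma π_S (s : V) : D.π (D.S s) = (0, s) := by simpa [S_apply] using D.π_apply 0 s

lemma π_T (s : V) : D.π (D.T s) = (s, 0) := by simpa using D.π_apply s 0

lemma S_injective : Function.Injective D.S := fun a b h => by
  have := congrArg D.π h
  simpa [π_S] using this

lemma T_injective : Function.Injective D.T := fun a b h => by
  have := congrArg D.π h
  simpa [π_T] using this

lemma S_Ad (k : K) (s : V) : D.S (D.Ad k s) = D.ρ (D.ι k) * D.S s * D.ρ (D.ι k⁻¹) := by
  simp [S_apply, D.T_Ad]

lemma E_zero : D.E 0 = 1 := D.injective_ρ (by simp [ρ_E])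

lemma e_zero : D.e (0, 0) = 1 := D.E_zero

lemma E_add_smul (s : V) (t t' : ℝ) : D.E ((t + t') • s) = D.E (t • s) * D.E (t' • s) := by
  apply D.injective_ρ
  rw [map_mul, ρ_E, ρ_E, ρ_E, ← exp_add_comm']
  · simp [add_smul]
  · simpa using ((Commute.refl (D.S s)).smul_left t).smul_right t'

lemma ρ_mul_ρ_inv (g : G) : D.ρ g * D.ρ g⁻¹ = 1 := by rw [← map_mul]; simp

lemma ρ_inv_mul_ρ (g : G) : D.ρ g⁻¹ * D.ρ g = 1 := by rw [← map_mul]; simp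

lemma ρ_E_inv (s : V) : D.ρ (D.E s)⁻¹ = exp (-D.S s) := by
  calc D.ρ (D.E s)⁻¹ = D.ρ (D.E s)⁻¹ * (exp (D.S s) * exp (-D.S s)) := by simp
    _ = exp (-D.S s) := by rw [← D.ρ_E, ← mul_assoc, ρ_inv_mul_ρ, one_mul]

lemma exists_B_eq (s r : V) : ∃ a b, D.B s r = D.T a + D.S b := D.exists_dexp_eq s r

/-- The coordinates of `exp a * exp (𝐢 (s + r)) * exp (- 𝐢 s) ∈ G` in the chart `π ∘ ρ` of `G` at
`1`. -/
noncomputable def theta (s : V) (p : V × V) : V × V :=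
  D.π (exp (D.T p.1) * exp (D.S (s + p.2)) * exp (-D.S s))

lemma π_ρ_eq_theta (s : V) (p : V × V) :
    D.π (D.ρ (D.e (p.1, 0) * D.E (s + p.2) * (D.E s)⁻¹)) = D.theta s p := by
  rw [map_mul D.ρ, map_mul D.ρ, D.ρ_e, ρ_E, ρ_E_inv]
  simp [theta]

/-- The differential at `0` of `D.theta s`. -/
noncomputable def thetaDeriv (s : V) : V × V →L[ℝ] V × V :=
  D.π.comp (D.T.comp (ContinuousLinearMap.fst ℝ V V) +
    (D.B s).comp (ContinuousLinearMap.snd ℝ V V))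

lemma thetaDeriv_apply (s : V) (p : V × V) :
    D.thetaDeriv s p = D.π (D.T p.1 + D.B s p.2) := rfl

lemma hasStrictFDerivAt_theta (s : V) : HasStrictFDerivAt (D.theta s) (D.thetaDeriv s) 0 := by
  have h1 : HasStrictFDerivAt (fun p : V × V => exp (D.T p.1))
      ((dexp (0 : A)).comp (D.T.comp (ContinuousLinearMap.fst ℝ V V))) 0 := by
    have h : HasStrictFDerivAt (fun p : V × V => D.T p.1)
      (D.T.comp (ContinuousLinearMap.fst ℝ V V)) 0 :=
      (D.T.comp (ContinuousLinearMap.fst ℝ V V)).hasStrictFDerivAt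
    refine HasStrictFDerivAt.comp (0 : V × V) ?_ h
    simpa using hasStrictFDerivAt_exp (0 : A)
  have h2 : HasStrictFDerivAt (fun p : V × V => exp (D.S (s + p.2)))
      ((dexp (D.S s)).comp (D.S.comp (ContinuousLinearMap.snd ℝ V V))) 0 := by
    have h : HasStrictFDerivAt (fun p : V × V => D.S (s + p.2))
      (D.S.comp (ContinuousLinearMap.snd ℝ V V)) 0 := by
      simpa using (D.S.comp (ContinuousLinearMap.snd ℝ V V)).hasStrictFDerivAt.const_add (D.S s)
    refine HasStrictFDerivAt.comp (0 : V × V) ?_ h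
    simpa using hasStrictFDerivAt_exp (D.S s)
  have h3 := D.π.hasStrictFDerivAt.comp (0 : V × V) ((h1.mul' h2).mul_const' (exp (-D.S s)))
  refine h3.congr_fderiv ?_
  ext1 <;> ext v
  all_goals simp [thetaDeriv_apply, B_apply, dexp_zero, mul_assoc]

/-- A kernel vector of the differential of `D.theta s` is an infinitesimal failure of uniqueness of
the polar decomposition in `A`. -/
lemma thetaDeriv_injective (s : V) : Function.Injective (D.thetaDeriv s) := by
  rw [injective_iff_map_eq_zero]
  rintro ⟨a, r⟩ h
  rw [thetaDeriv_apply] at h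
  obtain ⟨a', b', hab⟩ := D.exists_B_eq s r
  have h1 : (a + a', b') = (0 : V × V) := by
    rw [← h, hab, ← D.π_apply, map_add D.T, ← S_apply, add_assoc]
  obtain ⟨h2, h3⟩ := Prod.mk.inj h1
  have h4 : D.T a + D.B s r = 0 := by
    rw [hab, h3, ← add_assoc, ← map_add, h2]; simp
  have h5 : D.T a * exp (D.S s) + dexp (D.S s) (D.S r) = 0 := by
    have := congrArg (· * exp (D.S s)) h4
    simpa [add_mul, B_apply, mul_assoc] using this
  obtain ⟨h6, h7⟩ := eq_zero_of_skew_mul_exp_add_dexp (D.star_T a) (D.isSelfAdjoint_S s)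
    (D.isSelfAdjoint_S r) h5
  rw [Prod.mk_eq_zero]
  exact ⟨D.T_injective (by simpa using h7), D.S_injective (by simpa using h6)⟩

/-- The `𝐢𝔨`-component of the logarithmic differential of `s ↦ exp (𝐢 s)`. -/
noncomputable def Q (s : V) : V →L[ℝ] V :=
  (ContinuousLinearMap.snd ℝ V V).comp (D.π.comp (D.B s))

lemma Q_apply (s r : V) : D.Q s r = (D.π (D.B s r)).2 := rfl

lemma B_eq (s r : V) : D.B s r = D.T (D.π (D.B s r)).1 + D.S (D.Q s r) := by
  obtain ⟨a, b, h⟩ := D.exists_B_eq s r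
  rw [Q_apply, h, S_apply, D.π_apply, ← S_apply]

lemma Q_injective (s : V) : Function.Injective (D.Q s) := by
  rw [injective_iff_map_eq_zero]
  intro r h
  have h1 := D.B_eq s r
  rw [h] at h1
  have h2 : D.thetaDeriv s (-(D.π (D.B s r)).1, r) = 0 := by
    rw [thetaDeriv_apply]
    nth_rewrite 2 [h1]
    simp
  have h3 := (D.thetaDeriv_injective s) (h2.trans (map_zero _).symm)
  exact (Prod.mk.inj h3).2

lemma B_smul_self (s : V) (t : ℝ) : D.B (t • s) s = D.S s := by
  rw [B_apply, dexp_of_commute, mul_assoc]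
  · simp
  · simpa using (Commute.refl (D.S s)).smul_left t

lemma Q_smul_self (s : V) (t : ℝ) : D.Q (t • s) s = s := by
  rw [Q_apply, B_smul_self, π_S]

lemma theta_zero (s : V) : D.theta s 0 = D.π 1 := by simp [theta]

/-- The set `ι(K) exp (𝐢𝔨)`. -/
def polarSet : Set G := Set.range fun p : K × V => D.ι p.1 * D.E p.2

lemma norm_ρ_ι (k : K) : ‖D.ρ (D.ι k)‖ ≤ 1 := by
  have h := CStarRing.norm_star_mul_self (x := D.ρ (D.ι k))
  rw [D.star_ρ_ι] at h
  have h1 : ‖(1 : A)‖ ≤ 1 := by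
    rcases subsingleton_or_nontrivial A with h | h
    · simp [Subsingleton.elim (1 : A) 0]
    · simp
  nlinarith [norm_nonneg (D.ρ (D.ι k))]

lemma eq_of_mul_E_eq {k k' : K} {s s' : V} (h : D.ι k * D.E s = D.ι k' * D.E s') : s = s' := by
  have := congrArg D.ρ h
  rw [map_mul, map_mul, ρ_E, ρ_E] at this
  exact D.S_injective (polar_unique (D.star_ρ_ι k) (D.star_ρ_ι k') (D.isSelfAdjoint_S s)
    (D.isSelfAdjoint_S s') this)

/-- The polar coordinates `(k, s)` of `g` are bounded in terms of the norms of `ρ g` and `ρ g⁻¹`. -/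
lemma isClosed_polarSet [FiniteDimensional ℝ V] [IsTopologicalGroup G] [T2Space G]
    [CompactSpace K] : IsClosed D.polarSet := by
  refine isClosed_of_closure_subset fun g hg => ?_
  -- near `g`, the polar coordinates of elements of the set stay in a compact set
  obtain ⟨C, hC⟩ : ∃ C, C = ‖D.ρ g‖ + ‖D.ρ g⁻¹‖ + 1 := ⟨_, rfl⟩
  have hC0 : 0 ≤ C := by rw [hC]; positivity
  let O : Set G := {h | ‖D.ρ h‖ < C ∧ ‖D.ρ h⁻¹‖ < C}
  have hρ := D.continuous_ρ
  have hO : IsOpen O := by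
    apply IsOpen.inter
    · exact isOpen_lt hρ.norm continuous_const
    · exact isOpen_lt (hρ.comp continuous_inv).norm continuous_const
  have hgO : g ∈ O := ⟨by rw [hC]; linarith [norm_nonneg (D.ρ g⁻¹)],
    by rw [hC]; linarith [norm_nonneg (D.ρ g)]⟩
  obtain ⟨c, -, hc⟩ := D.S.exists_antilipschitzWith (LinearMap.ker_eq_bot.2 D.S_injective)
  let P : Set (K × V) := Set.univ ×ˢ Metric.closedBall 0 (c * C)
  have hP : IsCompact P := isCompact_univ.prod (isCompact_closedBall _ _)
  have hι := D.continuous_ι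
  have hE := D.continuous_E
  have him : IsClosed ((fun p : K × V => D.ι p.1 * D.E p.2) '' P) :=
    (hP.image (by fun_prop)).isClosed
  have hsub : O ∩ D.polarSet ⊆ (fun p : K × V => D.ι p.1 * D.E p.2) '' P := by
    rintro _ ⟨⟨h1, h2⟩, ⟨⟨k, s⟩, rfl⟩⟩
    refine ⟨(k, s), ⟨trivial, ?_⟩, rfl⟩
    simp only at h1 h2 ⊢
    rw [mem_closedBall_zero_iff]
    have h3 : exp (D.S s) = D.ρ (D.ι k⁻¹) * D.ρ (D.ι k * D.E s) := by
      rw [← ρ_E, ← map_mul]; simp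
    have h4 : exp (-D.S s) = D.ρ (D.ι k * D.E s)⁻¹ * D.ρ (D.ι k) := by
      rw [← ρ_E_inv, ← map_mul]; simp
    have h5 : ‖D.S s‖ ≤ C := by
      refine norm_le_of_norm_exp_le (D.isSelfAdjoint_S s) hC0 ?_ ?_
      · rw [h3]
        refine (norm_mul_le _ _).trans ?_
        have := D.norm_ρ_ι k⁻¹
        nlinarith [norm_nonneg (D.ρ (D.ι k * D.E s))]
      · rw [h4]
        refine (norm_mul_le _ _).trans ?_
        have := D.norm_ρ_ι k
        nlinarith [norm_nonneg (D.ρ (D.ι k * D.E s)⁻¹)]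
    have h6 := hc.le_mul_dist s 0
    simp only [map_zero, dist_zero_right] at h6
    exact h6.trans (mul_le_mul_of_nonneg_left h5 c.coe_nonneg)
  have h1 : g ∈ closure (O ∩ D.polarSet) := hO.inter_closure ⟨hgO, hg⟩
  obtain ⟨p, -, hp⟩ := closure_minimal hsub him h1
  exact ⟨p, hp⟩

variable [FiniteDimensional ℝ V]

lemma Q_surjective (s : V) : Function.Surjective (D.Q s) :=
  LinearMap.injective_iff_surjective.1 (D.Q_injective s)

/-- The differential at `0` of `D.theta s`, as an isomorphism. -/
noncomputable def thetaEquiv (s : V) : (V × V) ≃L[ℝ] (V × V) :=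
  (LinearEquiv.ofInjectiveEndo (D.thetaDeriv s).toLinearMap
    (D.thetaDeriv_injective s)).toContinuousLinearEquiv

lemma thetaEquiv_apply (s : V) (p : V × V) : D.thetaEquiv s p = D.thetaDeriv s p := rfl

lemma hasStrictFDerivAt_theta' (s : V) :
    HasStrictFDerivAt (D.theta s) (D.thetaEquiv s : (V × V) →L[ℝ] (V × V)) 0 :=
  (D.hasStrictFDerivAt_theta s).congr_fderiv (by ext1 <;> rfl)

/-- The local inverse of `D.theta s` near `0`. -/
noncomputable def thetaInv (s : V) : V × V → V × V :=
  (D.hasStrictFDerivAt_theta' s).localInverse _ _ _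

lemma hasStrictFDerivAt_thetaInv (s : V) :
    HasStrictFDerivAt (D.thetaInv s) ((D.thetaEquiv s).symm : (V × V) →L[ℝ] (V × V))
      (D.π 1) := by
  have := (D.hasStrictFDerivAt_theta' s).to_localInverse
  rwa [theta_zero] at this

lemma thetaInv_π_one (s : V) : D.thetaInv s (D.π 1) = 0 := by
  have := (D.hasStrictFDerivAt_theta' s).localInverse_apply_image
  rwa [theta_zero] at this

variable [IsTopologicalGroup G]

/-- If `g : X → G` tends to `1`, then `g = exp a * exp (𝐢 (s + r)) * exp (- 𝐢 s)` eventually, where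
`(a, r)` is obtained from `g` by the local inverse of `D.theta s`. -/
lemma eventually_eq_of_tendsto (s : V) {X : Type*} {l : Filter X} {g : X → G}
    (hg : Filter.Tendsto g l (𝓝 1)) :
    ∀ᶠ x in l, D.e ((D.thetaInv s (D.π (D.ρ (g x)))).1, 0) *
      D.E (s + (D.thetaInv s (D.π (D.ρ (g x)))).2) * (D.E s)⁻¹ = g x := by
  obtain ⟨N, hN, hinj⟩ := D.exists_injOn
  have hw : Filter.Tendsto (fun x => D.π (D.ρ (g x))) l (𝓝 (D.π 1)) := by
    have := ((D.π.continuous.comp D.continuous_ρ).tendsto 1).comp hg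
    simpa [Function.comp_def] using this
  have hi : Filter.Tendsto (fun x => D.thetaInv s (D.π (D.ρ (g x)))) l (𝓝 0) := by
    have h1 := (D.hasStrictFDerivAt_thetaInv s).continuousAt
    rw [ContinuousAt, thetaInv_π_one] at h1
    exact h1.comp hw
  have hΘ : Continuous (fun p : V × V => D.e (p.1, 0) * D.E (s + p.2) * (D.E s)⁻¹) := by
    have h1 := D.continuous_e
    have h2 := D.continuous_E
    fun_prop
  have h3 : ∀ᶠ x in l, D.e ((D.thetaInv s (D.π (D.ρ (g x)))).1, 0) *
      D.E (s + (D.thetaInv s (D.π (D.ρ (g x)))).2) * (D.E s)⁻¹ ∈ N := by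
    have := (hΘ.tendsto 0).comp hi
    simp only [Prod.fst_zero, Prod.snd_zero, e_zero, add_zero, one_mul, mul_inv_cancel] at this
    exact this hN
  have h6 : ∀ᶠ x in l, D.theta s (D.thetaInv s (D.π (D.ρ (g x)))) = D.π (D.ρ (g x)) := by
    have h := (D.hasStrictFDerivAt_theta' s).eventually_right_inverse
    rw [theta_zero] at h
    exact hw h
  filter_upwards [h3, hg hN, h6] with x h4 h5 h6
  refine hinj h4 h5 ?_
  simp only
  rw [π_ρ_eq_theta]
  exact h6

/-- `D.theta s` is a local diffeomorphism at `0`, so the set is a neighbourhood of each of its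
points. -/
lemma isOpen_polarSet : IsOpen D.polarSet := by
  rw [isOpen_iff_mem_nhds]
  rintro _ ⟨⟨k, s⟩, rfl⟩
  have h : Filter.Tendsto (fun g => (D.ι k)⁻¹ * g * (D.E s)⁻¹) (𝓝 (D.ι k * D.E s)) (𝓝 1) := by
    have : Continuous fun g => (D.ι k)⁻¹ * g * (D.E s)⁻¹ := by fun_prop
    have := this.tendsto (D.ι k * D.E s)
    simpa using this
  filter_upwards [D.eventually_eq_of_tendsto s h] with g hg
  obtain ⟨k', hk'⟩ := D.exists_ι_eq (D.thetaInv s (D.π (D.ρ ((D.ι k)⁻¹ * g * (D.E s)⁻¹)))).1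
  refine ⟨(k * k', s + (D.thetaInv s (D.π (D.ρ ((D.ι k)⁻¹ * g * (D.E s)⁻¹)))).2), ?_⟩
  rw [mul_left_inj] at hg
  simp only
  rw [map_mul D.ι, hk', mul_assoc, hg]
  simp

variable [T2Space G] [CompactSpace K] [ConnectedSpace G]

lemma polarSet_eq_univ : D.polarSet = Set.univ :=
  IsClopen.eq_univ ⟨D.isClosed_polarSet, D.isOpen_polarSet⟩ ⟨_, ⟨(1, 0), rfl⟩⟩

/-- The polar decomposition of `G`. -/
lemma exists_polar (g : G) : ∃ k s, g = D.ι k * D.E s := by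
  obtain ⟨⟨k, s⟩, h⟩ := D.polarSet_eq_univ.symm ▸ Set.mem_univ g
  exact ⟨k, s, h.symm⟩

/-- The unique `s` with `g ∈ ι(K) exp (𝐢 s)`. -/
noncomputable def σ (g : G) : V := (D.exists_polar g).choose_spec.choose

lemma exists_eq_mul_E_σ (g : G) : ∃ k, g = D.ι k * D.E (D.σ g) :=
  ⟨_, (D.exists_polar g).choose_spec.choose_spec⟩

lemma σ_mul_E (k : K) (s : V) : D.σ (D.ι k * D.E s) = s := by
  obtain ⟨k', h⟩ := D.exists_eq_mul_E_σ (D.ι k * D.E s)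
  exact (D.eq_of_mul_E_eq h).symm

/-- Along a curve `γ` in `G` with `γ' = 𝐢 s γ`, the differential of the polar coordinate `σ`, read
through `D.Q`, is `Ad (k⁻¹) s`, where `γ = k exp (𝐢 σ)`. -/
lemma exists_hasDerivAt_σ {γ : ℝ → G} {t : ℝ} {s : V} (hγ : ContinuousAt γ t)
    (hd : HasDerivAt (fun t => D.ρ (γ t)) (D.S s * D.ρ (γ t)) t) {k : K}
    (hk : γ t = D.ι k * D.E (D.σ (γ t))) :
    ∃ r, HasDerivAt (fun t => D.σ (γ t)) r t ∧ D.Q (D.σ (γ t)) r = D.Ad k⁻¹ s := by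
  set s₀ := D.σ (γ t) with hs₀
  have hg : Filter.Tendsto (fun u => (D.ι k)⁻¹ * γ u * (D.E s₀)⁻¹) (𝓝 t) (𝓝 1) := by
    have h1 : ContinuousAt (fun u => (D.ι k)⁻¹ * γ u * (D.E s₀)⁻¹) t := by fun_prop
    have h2 : (D.ι k)⁻¹ * γ t * (D.E s₀)⁻¹ = 1 := by rw [hk]; simp
    rwa [ContinuousAt, h2] at h1
  have hw : HasDerivAt (fun u => D.π (D.ρ ((D.ι k)⁻¹ * γ u * (D.E s₀)⁻¹)))
      (0, D.Ad k⁻¹ s) t := by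
    have h1 := (hd.const_mul (D.ρ (D.ι k)⁻¹)).mul_const (D.ρ (D.E s₀)⁻¹)
    have h2 := D.π.hasFDerivAt.comp_hasDerivAt t h1
    have h3 : D.ρ (D.ι k)⁻¹ * (D.S s * D.ρ (γ t)) * D.ρ (D.E s₀)⁻¹ = D.S (D.Ad k⁻¹ s) := by
      rw [S_Ad, hk, map_mul D.ρ]
      simp only [mul_assoc, ρ_mul_ρ_inv, mul_one, map_inv, inv_inv]
    rw [h3, π_S] at h2
    simpa only [Function.comp_def, map_mul] using h2
  have hi : HasDerivAt (fun u => D.thetaInv s₀ (D.π (D.ρ ((D.ι k)⁻¹ * γ u * (D.E s₀)⁻¹))))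
      ((D.thetaEquiv s₀).symm (0, D.Ad k⁻¹ s)) t := by
    have h1 : D.π (D.ρ ((D.ι k)⁻¹ * γ t * (D.E s₀)⁻¹)) = D.π 1 := by rw [hk]; simp
    have h2 := (D.hasStrictFDerivAt_thetaInv s₀).hasFDerivAt
    rw [← h1] at h2
    exact h2.comp_hasDerivAt t hw
  set p := (D.thetaEquiv s₀).symm (0, D.Ad k⁻¹ s) with hp
  have hi2 : HasDerivAt (fun u => s₀ +
      (D.thetaInv s₀ (D.π (D.ρ ((D.ι k)⁻¹ * γ u * (D.E s₀)⁻¹)))).2) p.2 t :=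
    ((ContinuousLinearMap.snd ℝ V V).hasFDerivAt.comp_hasDerivAt t hi).const_add s₀
  refine ⟨p.2, hi2.congr_of_eventuallyEq ?_, ?_⟩
  · filter_upwards [D.eventually_eq_of_tendsto s₀ hg] with u hu
    rw [mul_left_inj] at hu
    obtain ⟨k', hk'⟩ := D.exists_ι_eq
      (D.thetaInv s₀ (D.π (D.ρ ((D.ι k)⁻¹ * γ u * (D.E s₀)⁻¹)))).1
    have h1 : γ u = D.ι (k * k') *
        D.E (s₀ + (D.thetaInv s₀ (D.π (D.ρ ((D.ι k)⁻¹ * γ u * (D.E s₀)⁻¹)))).2) := by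
      rw [map_mul, hk', mul_assoc, hu]
      simp
    conv_lhs => rw [h1]
    rw [σ_mul_E]
  · have h1 : D.thetaDeriv s₀ p = (0, D.Ad k⁻¹ s) := by
      rw [← thetaEquiv_apply, hp, ContinuousLinearEquiv.apply_symm_apply]
    rw [thetaDeriv_apply, map_add, π_T] at h1
    have h2 := congrArg Prod.snd h1
    simpa [Q_apply] using h2

/-- A ray `t ↦ exp (𝐢 t s) g`, `s ≠ 0`, is unbounded in polar coordinates. -/
lemma not_bounded_σ {s : V} (hs : s ≠ 0) (g : G) (R : ℝ) :
    ∃ t : ℝ, 0 ≤ t ∧ R < ‖D.σ (D.E (t • s) * g)‖ := by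
  by_contra! hR
  -- otherwise `exp (± 𝐢 t s)` and hence `t 𝐢 s` would be bounded in `A`
  obtain ⟨C, hC⟩ : ∃ C : ℝ, ∀ v : V, ‖v‖ ≤ R → ‖exp (D.S v)‖ ≤ C ∧ ‖exp (-D.S v)‖ ≤ C := by
    have hc : IsCompact (Metric.closedBall (0 : V) R) := isCompact_closedBall 0 R
    have h1 : Continuous fun v => exp (D.S v) :=
      contDiff_exp_cstar.continuous.comp D.S.continuous
    have h2 : Continuous fun v => exp (-D.S v) :=
      contDiff_exp_cstar.continuous.comp D.S.continuous.neg
    obtain ⟨C₁, hC₁⟩ := hc.exists_bound_of_continuousOn h1.continuousOn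
    obtain ⟨C₂, hC₂⟩ := hc.exists_bound_of_continuousOn h2.continuousOn
    refine ⟨max C₁ C₂, fun v hv => ⟨(hC₁ v (by simpa using hv)).trans (le_max_left _ _),
      (hC₂ v (by simpa using hv)).trans (le_max_right _ _)⟩⟩
  have hC0 : 0 ≤ C := (norm_nonneg _).trans (hC _ (hR 0 le_rfl)).1
  have key : ∀ t : ℝ, 0 ≤ t → ‖t • D.S s‖ ≤ C * ‖D.ρ g⁻¹‖ + ‖D.ρ g‖ * C := by
    intro t ht
    obtain ⟨k, hk⟩ := D.exists_eq_mul_E_σ (D.E (t • s) * g)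
    obtain ⟨h1, h2⟩ := hC _ (hR t ht)
    have h3 : D.E (t • s) = D.ι k * D.E (D.σ (D.E (t • s) * g)) * g⁻¹ := by rw [← hk]; simp
    have h4 : (D.E (t • s))⁻¹ = g * (D.E (D.σ (D.E (t • s) * g)))⁻¹ * D.ι k⁻¹ := by
      nth_rewrite 1 [h3]; simp [mul_assoc]
    have h5 := congrArg D.ρ h3
    have h6 := congrArg D.ρ h4
    rw [map_mul, map_mul, ρ_E, ρ_E] at h5
    rw [map_mul, map_mul, ρ_E_inv, ρ_E_inv] at h6
    have hg1 := norm_nonneg (D.ρ g)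
    have hg2 := norm_nonneg (D.ρ g⁻¹)
    rw [← map_smul]
    refine norm_le_of_norm_exp_le (D.isSelfAdjoint_S _) (by positivity) ?_ ?_
    · rw [h5]
      calc _ ≤ 1 * C * ‖D.ρ g⁻¹‖ := by
            refine (norm_mul_le _ _).trans ?_
            gcongr
            refine (norm_mul_le _ _).trans ?_
            gcongr
            exact D.norm_ρ_ι k
        _ ≤ _ := by nlinarith
    · rw [h6]
      calc _ ≤ ‖D.ρ g‖ * C * 1 := by
            refine (norm_mul_le _ _).trans ?_
            gcongr
            · refine (norm_mul_le _ _).trans ?_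
              gcongr
            exact D.norm_ρ_ι k⁻¹
        _ ≤ _ := by nlinarith
  have hpos : 0 < ‖D.S s‖ := norm_pos_iff.2 fun h => hs (D.S_injective (by simpa using h))
  set M := C * ‖D.ρ g⁻¹‖ + ‖D.ρ g‖ * C
  have hM : 0 ≤ M := by positivity
  have := key ((M + 1) / ‖D.S s‖) (by positivity)
  rw [norm_smul, Real.norm_of_nonneg (by positivity), div_mul_cancel₀ _ hpos.ne'] at this
  linarith

end PolarData

/-! ### Moment maps along polar coordinates -/

/-- The data of a moment map `m` on a space `F` acted on by `G`, along the curves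
`t ↦ exp (𝐢 (s + t q)) y`. The form `gp p` on `V = 𝔨` is the Kähler metric on the vectors of the
infinitesimal action at `p`. The field `E_smul_eq` says that a vector `b` of `𝔨` that vanishes at
`p` generates a ray `exp (𝐢 t b)` fixing `p`, and `eventually_eq_zero` that the stabiliser of `p` in
`K` is discrete if no nonzero vector of `𝔨` vanishes at `p`. The field `hasDerivAt` computes the
derivative of `⟨m, d⟩` along `a + 𝐢 b`, the velocity of the curve, as `gp b d - ⟨m, [a, d]⟩`.
Brackets in `V` are expressed by commutators in `A`. -/
structure MomentData {K G V A : Type*} [Group K] [TopologicalSpace K] [Group G]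
    [TopologicalSpace G] [NormedAddCommGroup V] [NormedSpace ℝ V] [CStarAlgebra A]
    (D : PolarData K G V A) (F : Type*) [MulAction G F] where
  m : F → V →L[ℝ] ℝ
  gp : F → V → V → ℝ
  gp_symm : ∀ p b d, gp p b d = gp p d b
  gp_nonneg : ∀ p b, 0 ≤ gp p b b
  E_smul_eq : ∀ p b, gp p b b = 0 → ∀ t : ℝ, D.E (t • b) • p = p
  eventually_eq_zero : ∀ p, (∀ b, b ≠ 0 → gp p b b ≠ 0) →
    ∀ᶠ a in 𝓝 (0 : V), D.e (a, 0) • p = p → a = 0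
  equivariant : ∀ k p s, m (D.ι k • p) (D.Ad k s) = m p s
  contDiff : ∀ y, ContDiff ℝ 1 fun s => m (D.E s • y)
  exists_bracket : ∀ a d, ∃ c, D.T c = D.T a * D.T d - D.T d * D.T a
  hasDerivAt : ∀ y s q d a b c, D.B s q = D.T a + D.S b → D.T c = D.T a * D.T d - D.T d * D.T a →
    HasDerivAt (fun t : ℝ => m (D.E (s + t • q) • y) d)
      (gp (D.E s • y) b d - m (D.E s • y) c) 0

namespace PolarData

variable {K G V A : Type*} [Group K] [TopologicalSpace K] [Group G] [TopologicalSpace G]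
  [NormedAddCommGroup V] [NormedSpace ℝ V] [CStarAlgebra A] (D : PolarData K G V A)

lemma contDiff_B : ContDiff ℝ ω D.B := by
  have h1 : ContDiff ℝ ω fun s : V => exp (-D.S s) :=
    contDiff_exp_cstar.comp D.S.contDiff.neg
  have h2 : ContDiff ℝ ω fun s : V => (dexp (D.S s)).comp D.S :=
    (contDiff_dexp.comp D.S.contDiff).clm_comp contDiff_const
  exact (((ContinuousLinearMap.mul ℝ A).flip.contDiff).comp h1).clm_comp h2

lemma contDiff_Q : ContDiff ℝ ω D.Q :=
  contDiff_const.clm_comp (contDiff_const.clm_comp D.contDiff_B)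

lemma hasFDerivAt_B (s : V) : HasFDerivAt D.B (fderiv ℝ D.B s) s :=
  (D.contDiff_B.differentiable (by simp) s).hasFDerivAt

lemma B_mul_exp (s r : V) : D.B s r * exp (D.S s) = dexp (D.S s) (D.S r) := by
  simp [B_apply, mul_assoc]

/-- The Maurer-Cartan equation for the logarithmic differential of `s ↦ exp (𝐢 s)`. -/
lemma fderiv_B_sub (s q r : V) : fderiv ℝ D.B s q r - fderiv ℝ D.B s r q =
    D.B s q * D.B s r - D.B s r * D.B s q := by
  have key : ∀ q r, fderiv ℝ D.B s q r * exp (D.S s) + D.B s r * (D.B s q * exp (D.S s)) =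
      fderiv ℝ dexp (D.S s) (D.S q) (D.S r) := by
    intro q r
    have hc : HasDerivAt (fun t : ℝ => s + t • q) q 0 := by
      simpa using ((hasDerivAt_id (0 : ℝ)).smul_const q).const_add s
    have h1 : HasDerivAt (fun t : ℝ => D.B (s + t • q)) (fderiv ℝ D.B s q) 0 := by
      have : HasFDerivAt D.B (fderiv ℝ D.B s) (s + (0 : ℝ) • q) := by
        simpa using D.hasFDerivAt_B s
      exact this.comp_hasDerivAt (0 : ℝ) hc
    have h1' : HasDerivAt (fun t : ℝ => D.B (s + t • q) r) (fderiv ℝ D.B s q r) 0 := by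
      simpa using h1.clm_apply (hasDerivAt_const (0 : ℝ) r)
    have h2 : HasDerivAt (fun t : ℝ => exp (D.S (s + t • q))) (D.B s q * exp (D.S s)) 0 := by
      rw [B_mul_exp]
      simpa using hasDerivAt_exp_line (D.S s) (D.S q)
    have h3 : HasDerivAt (fun t : ℝ => dexp (D.S (s + t • q)))
        (fderiv ℝ dexp (D.S s) (D.S q)) 0 := by
      have h4 : HasFDerivAt dexp (fderiv ℝ dexp (D.S s)) (D.S (s + (0 : ℝ) • q)) := by
        simpa using (contDiff_dexp.differentiable (by simp) (D.S s)).hasFDerivAt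
      exact h4.comp_hasDerivAt (0 : ℝ) (D.S.hasFDerivAt.comp_hasDerivAt (0 : ℝ) hc)
    have h3' := h3.clm_apply (hasDerivAt_const (0 : ℝ) (D.S r))
    have h5 := h1'.mul h2
    have h6 : ((fun t : ℝ => D.B (s + t • q) r) * fun t : ℝ => exp (D.S (s + t • q)))
        = fun t : ℝ => dexp (D.S (s + t • q)) (D.S r) := by
      funext t
      exact D.B_mul_exp _ _
    rw [h6] at h5
    simpa using h5.unique h3'
  have hsymm : fderiv ℝ dexp (D.S s) (D.S q) (D.S r) = fderiv ℝ dexp (D.S s) (D.S r) (D.S q) := by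
    have : IsSymmSndFDerivAt ℝ (exp : A → A) (D.S s) :=
      contDiff_exp_cstar.contDiffAt.isSymmSndFDerivAt (by simp)
    exact this.eq _ _
  have h1 := (key q r).trans (hsymm.trans (key r q).symm)
  have h2 := congrArg (· * exp (-D.S s)) h1
  simp only [add_mul, mul_assoc, exp_mul_exp_neg, mul_one] at h2
  rw [sub_eq_sub_iff_add_eq_add, h2, add_comm]

lemma fderiv_Q_apply (s q r : V) : fderiv ℝ D.Q s q r = (D.π (fderiv ℝ D.B s q r)).2 := by
  have h1 : HasFDerivAt D.Q _ s :=
    (hasFDerivAt_const _ s).clm_comp ((hasFDerivAt_const _ s).clm_comp (D.hasFDerivAt_B s))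
  rw [h1.fderiv]
  simp

end PolarData

namespace MomentData

variable {K G V A F : Type*} [Group K] [TopologicalSpace K] [Group G] [TopologicalSpace G]
  [NormedAddCommGroup V] [NormedSpace ℝ V] [CStarAlgebra A] {D : PolarData K G V A}
  [MulAction G F] (M : MomentData D F)

/-- The weight `⟨m (exp (𝐢 t s) y), s⟩`. -/
def w (y : F) (s : V) (t : ℝ) : ℝ := M.m (D.E (t • s) • y) s

lemma w_zero (y : F) (s : V) : M.w y s 0 = M.m y s := by simp [w, D.E_zero]

lemma hasDerivAt_w (y : F) (s : V) (t : ℝ) :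
    HasDerivAt (M.w y s) (M.gp (D.E (t • s) • y) s s) t := by
  have h1 := M.hasDerivAt y (t • s) s s 0 s 0 (by simp [D.B_smul_self]) (by simp)
  have h2 : HasDerivAt (fun u : ℝ => M.m (D.E (t • s + u • s) • y) s)
      (M.gp (D.E (t • s) • y) s s) (t - t) := by
    simpa only [map_zero, sub_zero, sub_self] using h1
  refine (h2.comp_sub_const t t).congr_of_eventuallyEq (Filter.Eventually.of_forall fun u => ?_)
  simp only [w, ← add_smul, add_sub_cancel]

lemma monotone_w (y : F) (s : V) : Monotone (M.w y s) :=
  monotone_of_deriv_nonneg (fun t => (M.hasDerivAt_w y s t).differentiableAt)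
    fun t => by rw [(M.hasDerivAt_w y s t).deriv]; exact M.gp_nonneg _ _

lemma continuous_w (y : F) (t : ℝ) : Continuous fun s => M.w y s t := by
  exact ((M.contDiff y).continuous.comp (continuous_const_smul t)).clm_apply continuous_id

/-- If the weight in direction `s` vanishes at times `0` and `1`, then it is constant in between, so
that `s` vanishes at the midpoint of the ray and the whole ray fixes `y`. -/
lemma gp_eq_zero_of_w_eq {y : F} {s : V} (h0 : M.w y s 0 = 0) (h1 : M.w y s 1 = 0) :
    M.gp y s s = 0 ∧ D.E s • y = y := by
  have hconst : ∀ t ∈ Set.Ioo (0 : ℝ) 1, M.w y s t = 0 := fun t ht =>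
    le_antisymm (h1 ▸ M.monotone_w y s ht.2.le) (h0 ▸ M.monotone_w y s ht.1.le)
  have h2 : HasDerivAt (M.w y s) 0 (1 / 2) := by
    refine (hasDerivAt_const (1 / 2 : ℝ) (0 : ℝ)).congr_of_eventuallyEq ?_
    filter_upwards [Ioo_mem_nhds (a := (0 : ℝ)) (b := 1) (by norm_num) (by norm_num)] with t ht
    exact hconst t ht
  have h3 := h2.unique (M.hasDerivAt_w y s (1 / 2))
  have h4 := M.E_smul_eq _ _ h3.symm
  have h5 : ∀ t : ℝ, D.E (t • s) • y = D.E ((1 / 2 : ℝ) • s) • y := fun t => by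
    have := h4 (t - 1 / 2)
    rw [← mul_smul, ← D.E_add_smul] at this
    simpa using this
  have h6 : D.E ((1 / 2 : ℝ) • s) • y = y := by
    rw [← h5 0]; simp [D.E_zero]
  refine ⟨by rw [h6] at h3; exact h3.symm, ?_⟩
  have := h5 1
  rwa [h6, one_smul] at this

lemma m_eq_zero_of_ι_smul {k : K} {p : F} (h : M.m (D.ι k • p) = 0) : M.m p = 0 := by
  ext s
  rw [← M.equivariant k, h]
  simp

/-- Two zeros of the moment map in the same `G`-orbit: the `exp (𝐢𝔨)` factor of an element joining
them fixes the first. -/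
lemma E_smul_of_m_eq_zero {y : F} {k : K} {s : V} (h0 : M.m y = 0)
    (h1 : M.m ((D.ι k * D.E s) • y) = 0) : M.gp y s s = 0 ∧ D.E s • y = y := by
  rw [mul_smul] at h1
  refine M.gp_eq_zero_of_w_eq (by rw [w_zero, h0]; rfl) ?_
  rw [w, one_smul, M.m_eq_zero_of_ι_smul h1]
  rfl

/-- The 1-form on `𝔨` obtained by pulling back `v ↦ ⟨m (g y), Im v⟩` on `G` by `s ↦ exp (𝐢 s)`. -/
noncomputable def form (y : F) (s : V) : V →L[ℝ] ℝ := (M.m (D.E s • y)).comp (D.Q s)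

lemma fderiv_m_apply (y : F) {s q d a b c : V} (h : D.B s q = D.T a + D.S b)
    (hc : D.T c = D.T a * D.T d - D.T d * D.T a) :
    fderiv ℝ (fun s => M.m (D.E s • y)) s q d =
      M.gp (D.E s • y) b d - M.m (D.E s • y) c := by
  have h2 : HasDerivAt (fun t : ℝ => M.m (D.E (s + t • q) • y))
      (fderiv ℝ (fun s => M.m (D.E s • y)) s q) 0 :=
    ((M.contDiff y).differentiable (by simp) s).hasFDerivAt.hasLineDerivAt q
  have h3 : HasDerivAt (fun t : ℝ => M.m (D.E (s + t • q) • y) d)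
      (fderiv ℝ (fun s => M.m (D.E s • y)) s q d) 0 := by
    simpa using h2.clm_apply (hasDerivAt_const (0 : ℝ) d)
  exact h3.unique (M.hasDerivAt y s q d a b c h hc)

lemma fderiv_form_apply (y : F) (s q r : V) : fderiv ℝ (M.form y) s q r =
    fderiv ℝ (fun s => M.m (D.E s • y)) s q (D.Q s r) +
      M.m (D.E s • y) (fderiv ℝ D.Q s q r) := by
  have h1 := ((M.contDiff y).differentiable (by simp) s).hasFDerivAt
  have h2 := (D.contDiff_Q.differentiable (by simp) s).hasFDerivAt
  have h3 : HasFDerivAt (M.form y) _ s := h1.clm_comp h2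
  rw [h3.fderiv]
  simp [add_comm]

/-- The form is closed: the terms of type `gp` cancel by symmetry of the metric, and the brackets by
the Maurer-Cartan equation and the equivariance of the moment map. -/
lemma fderiv_form_symm (y : F) (s q r : V) :
    fderiv ℝ (M.form y) s q r = fderiv ℝ (M.form y) s r q := by
  set a := (D.π (D.B s q)).1
  set b := D.Q s q
  set c := (D.π (D.B s r)).1
  set d := D.Q s r
  have hq : D.B s q = D.T a + D.S b := D.B_eq s q
  have hr : D.B s r = D.T c + D.S d := D.B_eq s r
  obtain ⟨u, hu⟩ := M.exists_bracket a d
  obtain ⟨v, hv⟩ := M.exists_bracket c b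
  obtain ⟨x, hx⟩ := M.exists_bracket a c
  obtain ⟨z, hz⟩ := M.exists_bracket b d
  have hbr : fderiv ℝ D.Q s q r - fderiv ℝ D.Q s r q = u - v := by
    rw [D.fderiv_Q_apply, D.fderiv_Q_apply, ← Prod.snd_sub, ← map_sub, D.fderiv_B_sub]
    have : D.B s q * D.B s r - D.B s r * D.B s q =
        D.T (x - z) + Complex.I • D.T (u - v) := by
      rw [hq, hr, D.S_apply, D.S_apply, map_sub, map_sub, hu, hv, hx, hz]
      simp only [add_mul, mul_add, smul_sub, smul_add, smul_mul_assoc, mul_smul_comm, smul_smul,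
        Complex.I_mul_I, neg_smul, one_smul]
      abel
    rw [this, D.π_apply]
  rw [M.fderiv_form_apply, M.fderiv_form_apply, M.fderiv_m_apply y hq hu,
    M.fderiv_m_apply y hr hv, M.gp_symm _ d b]
  have := congrArg (M.m (D.E s • y)) hbr
  rw [map_sub, map_sub] at this
  linarith

/-- The Kempf-Ness function of `y` on `𝔨`, a potential of `M.form y`. -/
lemma exists_potential (y : F) : ∃ Ψ : V → ℝ, ∀ s, HasFDerivAt Ψ (M.form y s) s := by
  have hd : Differentiable ℝ (M.form y) :=
    (((M.contDiff y).clm_comp (D.contDiff_Q.of_le (by simp)))).differentiable (by simp)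
  obtain ⟨Ψ, h⟩ := convex_univ.exists_forall_hasFDerivAt_of_fderiv_symmetric isOpen_univ
    hd.differentiableOn (fun s _ q r => M.fderiv_form_symm y s q r)
  exact ⟨Ψ, fun s => h s trivial⟩

/-- Every weight of `y` is eventually positive. -/
def Positive (y : F) : Prop := ∀ s : V, s ≠ 0 → ∃ t : ℝ, 0 < M.w y s t

lemma Positive.gp_ne_zero {y : F} (hy : M.Positive y) (h0 : M.m y = 0) {b : V} (hb : b ≠ 0) :
    M.gp y b b ≠ 0 := by
  intro h
  obtain ⟨t, ht⟩ := hy b hb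
  rw [w, M.E_smul_eq y b h, h0] at ht
  exact lt_irrefl _ ht

/-- A zero of the moment map with finite stabiliser has positive weights. -/
lemma positive_of_finite_stabilizer {y : F} (h0 : M.m y = 0)
    (hfin : (MulAction.stabilizer G y : Set G).Finite) : M.Positive y := by
  intro s hs
  by_contra! hle
  have hw0 : M.w y s 0 = 0 := by rw [w_zero, h0]; rfl
  have hw1 : M.w y s 1 = 0 := le_antisymm (hle 1) (hw0 ▸ M.monotone_w y s zero_le_one)
  have h1 := M.E_smul_eq y s (M.gp_eq_zero_of_w_eq hw0 hw1).1
  have hinj : Function.Injective fun t : ℝ => D.E (t • s) := by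
    intro t t' h
    have h2 : t • s = t' • s := D.eq_of_mul_E_eq (k := 1) (k' := 1) (by simpa using h)
    exact smul_left_injective ℝ hs h2
  refine Set.infinite_range_of_injective hinj (hfin.subset ?_)
  rintro _ ⟨t, rfl⟩
  exact h1 t

variable [FiniteDimensional ℝ V]

/-- By compactness of the unit sphere the weights of unit vectors are positive from a common time
on. -/
lemma Positive.exists_uniform {y : F} (hy : M.Positive y) :
    ∃ R > 0, ∃ c > 0, ∀ u : V, ‖u‖ = 1 → ∀ t ≥ R, c ≤ M.w y u t := by
  have hS : IsCompact (Metric.sphere (0 : V) 1) := isCompact_sphere 0 1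
  obtain ⟨n, hn⟩ := hS.elim_directed_cover (fun n : ℕ => {u | 0 < M.w y u n})
    (fun n => isOpen_lt continuous_const (M.continuous_w y n))
    (fun u hu => by
      have hu0 : u ≠ 0 := by
        rintro rfl
        simp at hu
      obtain ⟨t, ht⟩ := hy u hu0
      obtain ⟨n, hn⟩ := exists_nat_ge t
      exact Set.mem_iUnion.2 ⟨n, ht.trans_le (M.monotone_w y u hn)⟩)
    (directed_of_isDirected_le fun i j hij u hu =>
      lt_of_lt_of_le (Set.mem_ofPred.1 hu) (M.monotone_w y u (by exact_mod_cast hij)))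
  have hpos : ∀ u ∈ Metric.sphere (0 : V) 1, 0 < M.w y u (n + 1) := fun u hu =>
    (hn hu).trans_le (M.monotone_w y u (by simp))
  obtain ⟨c, hc, hle⟩ : ∃ c > 0, ∀ u ∈ Metric.sphere (0 : V) 1, c ≤ M.w y u (n + 1) := by
    rcases (Metric.sphere (0 : V) 1).eq_empty_or_nonempty with he | hne
    · exact ⟨1, one_pos, by simp [he]⟩
    · obtain ⟨u, hu, hmin⟩ := hS.exists_isMinOn hne (M.continuous_w y (n + 1)).continuousOn
      exact ⟨_, hpos u hu, fun v hv => hmin hv⟩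
  exact ⟨n + 1, by positivity, c, hc, fun u hu t ht =>
    (hle u (by simpa using hu)).trans (M.monotone_w y u ht)⟩

/-- The Kempf-Ness function grows at least linearly if all weights are eventually positive, since
its derivative along the ray through `u` is the weight of `u`. -/
lemma Positive.exists_linear_growth {y : F} (hy : M.Positive y) {Ψ : V → ℝ}
    (hΨ : ∀ s, HasFDerivAt Ψ (M.form y s) s) : ∃ c > 0, ∃ C, ∀ s, c * ‖s‖ - C ≤ Ψ s := by
  obtain ⟨R, hR, c, hc, h⟩ := hy.exists_uniform
  have hcont : Continuous Ψ := continuous_iff_continuousAt.2 fun s => (hΨ s).continuousAt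
  obtain ⟨C, hC⟩ := (isCompact_closedBall (0 : V) R).exists_bound_of_continuousOn hcont.continuousOn
  refine ⟨c, hc, c * R + C, fun s => ?_⟩
  rcases le_total ‖s‖ R with hs | hs
  · have h1 := hC s (by simpa using hs)
    rw [Real.norm_eq_abs, abs_le] at h1
    have : c * ‖s‖ ≤ c * R := by gcongr
    linarith [h1.1]
  · have hs0 : 0 < ‖s‖ := hR.trans_le hs
    set u := ‖s‖⁻¹ • s with hu
    have hu1 : ‖u‖ = 1 := by rw [hu, norm_smul, norm_inv, norm_norm, inv_mul_cancel₀ hs0.ne']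
    have hsu : ‖s‖ • u = s := by rw [hu, smul_smul, mul_inv_cancel₀ hs0.ne', one_smul]
    have hd : ∀ t : ℝ, HasDerivAt (fun t : ℝ => Ψ (t • u)) (M.w y u t) t := by
      intro t
      have h1 : HasDerivAt (fun t : ℝ => t • u) u t := by
        simpa using (hasDerivAt_id t).smul_const u
      have h2 := (hΨ (t • u)).comp_hasDerivAt t h1
      have h3 : M.form y (t • u) u = M.w y u t := by
        rw [form, ContinuousLinearMap.comp_apply, D.Q_smul_self, w]
      rwa [h3] at h2
    have h3 := (convex_Icc R ‖s‖).mul_sub_le_image_sub_of_le_deriv (f := fun t : ℝ => Ψ (t • u))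
      (C := c) (fun t _ => (hd t).continuousAt.continuousWithinAt)
      (fun t _ => (hd t).differentiableAt.differentiableWithinAt)
      (fun t ht => by
        rw [(hd t).deriv]
        rw [interior_Icc] at ht
        exact h u hu1 t ht.1.le)
      R (Set.left_mem_Icc.2 hs) ‖s‖ (Set.right_mem_Icc.2 hs) hs
    simp only [hsu] at h3
    have h4 := hC (R • u) (by simp [norm_smul, hu1, abs_of_pos hR])
    rw [Real.norm_eq_abs, abs_le] at h4
    linarith [h4.1]

/-- The Kempf-Ness function has a minimum, and its critical points are zeros of the moment map. -/
lemma Positive.exists_zero {x : F} (hx : M.Positive x) : ∃ s, M.m (D.E s • x) = 0 := by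
  obtain ⟨Ψ, hΨ⟩ := M.exists_potential x
  obtain ⟨c, hc, C, hgrow⟩ := hx.exists_linear_growth M hΨ
  have hcont : Continuous Ψ := continuous_iff_continuousAt.2 fun s => (hΨ s).continuousAt
  have htend : Filter.Tendsto Ψ (Filter.cocompact V) Filter.atTop := by
    refine Filter.tendsto_atTop_mono hgrow ?_
    exact Filter.tendsto_atTop_add_const_right _ _
      ((tendsto_norm_cocompact_atTop (E := V)).const_mul_atTop hc)
  obtain ⟨s, hs⟩ := hcont.exists_forall_le htend
  have h1 : M.form x s = 0 :=
    (IsLocalMin.hasFDerivAt_eq_zero (Filter.Eventually.of_forall hs) (hΨ s))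
  refine ⟨s, ?_⟩
  ext v
  obtain ⟨r, rfl⟩ := D.Q_surjective s v
  exact DFunLike.congr_fun h1 r

variable [IsTopologicalGroup G] [T2Space G] [CompactSpace K] [ConnectedSpace G]

/-- Eventual positivity of the weights is invariant under `G`: along `exp (𝐢 t s) g` the Kempf-Ness
function of `y` has derivative the weight of `g y`, while polar coordinates are unbounded there. -/
lemma Positive.smul {y : F} (hy : M.Positive y) (g : G) : M.Positive (g • y) := by
  intro s hs
  by_contra! hle
  obtain ⟨Ψ, hΨ⟩ := M.exists_potential y
  obtain ⟨c, hc, C, hgrow⟩ := hy.exists_linear_growth M hΨ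
  have hcE := D.continuous_E
  set γ : ℝ → G := fun t => D.E (t • s) * g with hγ
  have hγc : Continuous γ := by fun_prop
  have hd : ∀ t, HasDerivAt (fun t => Ψ (D.σ (γ t))) (M.w (g • y) s t) t := by
    intro t
    have h1 : HasDerivAt (fun t => D.ρ (γ t)) (D.S s * D.ρ (γ t)) t := by
      have := (hasDerivAt_exp_smul (D.S s) t).mul_const (D.ρ g)
      simpa [hγ, D.ρ_E, mul_assoc] using this
    obtain ⟨k, hk⟩ := D.exists_eq_mul_E_σ (γ t)
    obtain ⟨r, hr, hQ⟩ := D.exists_hasDerivAt_σ hγc.continuousAt h1 hk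
    have h2 := (hΨ (D.σ (γ t))).comp_hasDerivAt t hr
    have h3 : M.form y (D.σ (γ t)) r = M.w (g • y) s t := by
      have h4 : D.E (D.σ (γ t)) • y = D.ι k⁻¹ • (γ t • y) := by
        nth_rewrite 2 [hk]
        rw [← mul_smul]
        simp
      rw [form, ContinuousLinearMap.comp_apply, hQ, h4, M.equivariant, hγ, mul_smul]
      rfl
    rwa [h3] at h2
  have hanti : Antitone fun t => Ψ (D.σ (γ t)) :=
    antitone_of_deriv_nonpos (fun t => (hd t).differentiableAt)
      fun t => by rw [(hd t).deriv]; exact hle t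
  obtain ⟨t, ht, hlt⟩ := D.not_bounded_σ hs g ((Ψ (D.σ (γ 0)) + C) / c)
  have h1 := hanti ht
  have h2 := hgrow (D.σ (γ t))
  rw [div_lt_iff₀ hc] at hlt
  simp only [hγ] at h1 h2
  linarith

variable [TopologicalSpace F] [T2Space F] [ContinuousSMul G F]

/-- The stabiliser of a zero `y` of the moment map with positive weights is contained in `ι(K)`,
hence compact, and it is discrete. -/
lemma Positive.finite_stabilizer {y : F} (hy : M.Positive y) (h0 : M.m y = 0) :
    (MulAction.stabilizer G y : Set G).Finite := by
  have hE : ∀ (k : K) (s : V), D.ι k * D.E s ∈ MulAction.stabilizer G y → s = 0 := by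
    intro k s hks
    by_contra hs
    refine hy.gp_ne_zero M h0 hs (M.E_smul_of_m_eq_zero (k := k) h0 ?_).1
    rw [MulAction.mem_stabilizer_iff.1 hks, h0]
  have hcl : IsClosed (MulAction.stabilizer G y : Set G) := by
    have h : Continuous fun g : G => g • y := by fun_prop
    exact isClosed_eq h continuous_const
  have hcomp : IsCompact (MulAction.stabilizer G y : Set G) := by
    refine (isCompact_range D.continuous_ι).of_isClosed_subset hcl fun g hg => ?_
    obtain ⟨k, s, rfl⟩ := D.exists_polar g
    refine ⟨k, ?_⟩
    rw [hE k s hg, D.E_zero, mul_one]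
  have hone : ∀ᶠ g in 𝓝 (1 : G), g ∈ MulAction.stabilizer G y → g = 1 := by
    have h1 := D.eventually_eq_of_tendsto 0 (Filter.tendsto_id (x := 𝓝 (1 : G)))
    have h2 : Filter.Tendsto (fun g : G => (D.thetaInv 0 (D.π (D.ρ g))).1) (𝓝 1) (𝓝 0) := by
      have h3 := (D.hasStrictFDerivAt_thetaInv 0).continuousAt
      rw [ContinuousAt, D.thetaInv_π_one] at h3
      have h4 : Filter.Tendsto (fun g : G => D.π (D.ρ g)) (𝓝 1) (𝓝 (D.π 1)) := by
        have := (D.π.continuous.comp D.continuous_ρ).tendsto 1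
        simpa [Function.comp_def] using this
      exact (continuous_fst.tendsto (0 : V × V)).comp (h3.comp h4)
    filter_upwards [h1, h2 (M.eventually_eq_zero y fun b hb => hy.gp_ne_zero M h0 hb)]
      with g hg hfix hmem
    simp only [id, D.E_zero, inv_one, mul_one, zero_add] at hg
    obtain ⟨k, hk⟩ := D.exists_ι_eq (D.thetaInv 0 (D.π (D.ρ g))).1
    have hr : (D.thetaInv 0 (D.π (D.ρ g))).2 = 0 := hE k _ (by rw [hk, hg]; exact hmem)
    rw [hr, D.E_zero, mul_one] at hg
    have ha : (D.thetaInv 0 (D.π (D.ρ g))).1 = 0 := hfix (by rw [hg]; exact hmem)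
    rw [← hg, ha, D.e_zero]
  have hdisc : DiscreteTopology (MulAction.stabilizer G y) := by
    refine discreteTopology_of_isOpen_singleton_one ?_
    rw [isOpen_singleton_iff_nhds_eq_pure]
    refine le_antisymm (Filter.le_pure_iff.2 ?_) (pure_le_nhds 1)
    have h1 : Filter.Tendsto (Subtype.val : MulAction.stabilizer G y → G) (𝓝 1) (𝓝 1) :=
      continuous_subtype_val.tendsto 1
    filter_upwards [h1 hone] with g hg
    exact Subtype.ext (hg g.2)
  have : CompactSpace (MulAction.stabilizer G y) := isCompact_iff_compactSpace.1 hcomp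
  have : Finite (MulAction.stabilizer G y) := finite_of_compact_of_discrete
  exact Set.toFinite _

end MomentData

/-! ### Differentials of maps of manifolds -/

section HasDiff

variable {E : Type*} [NormedAddCommGroup E] [NormedSpace ℝ E]
  {M : Type*} [TopologicalSpace M] [ChartedSpace E M]
  {E' : Type*} [NormedAddCommGroup E'] [NormedSpace ℝ E']
  {M' : Type*} [TopologicalSpace M'] [ChartedSpace E' M']
  {E'' : Type*} [NormedAddCommGroup E''] [NormedSpace ℝ E'']
  {M'' : Type*} [TopologicalSpace M''] [ChartedSpace E'' M'']

/-- `f` has differential `f'` at `x`, where tangent spaces are identified with the model spaces. -/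
def HasDiff (f : M → M') (x : M) (f' : E →L[ℝ] E') : Prop :=
  HasMFDerivAt 𝓘(ℝ, E) 𝓘(ℝ, E') f x f'

lemma HasDiff.unique {f : M → M'} {x : M} {f₁ f₂ : E →L[ℝ] E'} (h₁ : HasDiff f x f₁)
    (h₂ : HasDiff f x f₂) : f₁ = f₂ :=
  hasMFDerivAt_unique h₁ h₂

lemma HasDiff.mfderiv_eq {f : M → M'} {x : M} {f' : E →L[ℝ] E'} (h : HasDiff f x f') :
    (mfderiv 𝓘(ℝ, E) 𝓘(ℝ, E') f x : E →L[ℝ] E') = f' :=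
  HasMFDerivAt.mfderiv h

lemma HasDiff.continuousAt {f : M → M'} {x : M} {f' : E →L[ℝ] E'} (h : HasDiff f x f') :
    ContinuousAt f x :=
  HasMFDerivAt.continuousAt h

lemma HasDiff.comp {f : M → M'} {g : M' → M''} {x : M} {y : M'} {f' : E →L[ℝ] E'}
    {g' : E' →L[ℝ] E''} (hg : HasDiff g y g') (hf : HasDiff f x f') (h : f x = y) :
    HasDiff (fun z => g (f z)) x (g'.comp f') := by
  subst h
  exact HasMFDerivAt.comp x hg hf

lemma HasDiff.congr {f g : M → M'} {x : M} {f' : E →L[ℝ] E'} (h : HasDiff f x f')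
    (hfg : ∀ z, g z = f z) : HasDiff g x f' := by
  rwa [show g = f from funext hfg]

lemma _root_.MDifferentiableAt.hasDiff {f : M → M'} {x : M}
    (h : MDifferentiableAt 𝓘(ℝ, E) 𝓘(ℝ, E') f x) :
    HasDiff (E := E) (E' := E') f x (mfderiv 𝓘(ℝ, E) 𝓘(ℝ, E') f x) :=
  MDifferentiableAt.hasMFDerivAt h

lemma HasDiff.mdifferentiableAt {f : M → M'} {x : M} {f' : E →L[ℝ] E'} (h : HasDiff f x f') :
    MDifferentiableAt 𝓘(ℝ, E) 𝓘(ℝ, E') f x :=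
  HasMFDerivAt.mdifferentiableAt h

lemma _root_.ContMDiff.exists_hasDiff {n : ℕ∞ω} {f : M → M'}
    (h : ContMDiff 𝓘(ℝ, E) 𝓘(ℝ, E') n f) (hn : n ≠ 0) (x : M) : ∃ f' : E →L[ℝ] E', HasDiff f x f' :=
  ⟨_, (h.mdifferentiable hn x).hasDiff⟩

lemma hasDiff_iff_hasFDerivAt {f : E → E'} {x : E} {f' : E →L[ℝ] E'} :
    HasDiff f x f' ↔ HasFDerivAt f f' x :=
  hasMFDerivAt_iff_hasFDerivAt

lemma hasDiff_iff_hasDerivAt {f : ℝ → E'} {x : ℝ} {v : E'} :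
    HasDiff f x ((1 : ℝ →L[ℝ] ℝ).smulRight v) ↔ HasDerivAt f v x := by
  rw [hasDiff_iff_hasFDerivAt, hasDerivAt_iff_hasFDerivAt]
  rfl

lemma hasDiff_id (x : M) : HasDiff (fun z : M => z) x (ContinuousLinearMap.id ℝ E) :=
  hasMFDerivAt_id x

lemma hasDiff_const (y : M') (x : M) : HasDiff (fun _ : M => y) x (0 : E →L[ℝ] E') :=
  hasMFDerivAt_const y x

/-- `γ` has velocity `v` at `t`. -/
def HasVel (γ : ℝ → M) (t : ℝ) (v : E) : Prop :=
  HasDiff γ t ((1 : ℝ →L[ℝ] ℝ).smulRight v)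

lemma HasDiff.hasVel {γ : ℝ → M} {t : ℝ} {f' : ℝ →L[ℝ] E} (h : HasDiff γ t f') :
    HasVel γ t (f' 1) := by
  have : (1 : ℝ →L[ℝ] ℝ).smulRight (f' 1) = f' := by ext; simp
  rwa [HasVel, this]

lemma HasDiff.comp_hasVel {f : M → M'} {γ : ℝ → M} {t : ℝ} {y : M} {f' : E →L[ℝ] E'} {v : E}
    (hf : HasDiff f y f') (hγ : HasVel γ t v) (h : γ t = y) :
    HasVel (fun u => f (γ u)) t (f' v) := by
  have := (hf.comp hγ h).hasVel
  simpa using this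

lemma hasVel_iff_hasDerivAt {γ : ℝ → E} {t : ℝ} {v : E} : HasVel γ t v ↔ HasDerivAt γ v t :=
  hasDiff_iff_hasDerivAt

lemma HasVel.congr {γ γ' : ℝ → M} {t : ℝ} {v : E} (h : HasVel γ t v) (hfg : ∀ z, γ' z = γ z) :
    HasVel γ' t v :=
  HasDiff.congr h hfg

lemma HasVel.unique {γ : ℝ → M} {t : ℝ} {v w : E} (h : HasVel γ t v) (h' : HasVel γ t w) :
    v = w := by
  have := DFunLike.congr_fun (HasDiff.unique h h') (1 : ℝ)
  simpa using this

lemma HasVel.of_eq {γ : ℝ → M} {t : ℝ} {v w : E} (h : HasVel γ t v) (hvw : v = w) :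
    HasVel γ t w :=
  hvw ▸ h

end HasDiff

/-! ### Complex manifolds as real manifolds -/

section RestrictScalars

variable {E : Type*} [NormedAddCommGroup E] [NormedSpace ℂ E]
  {M : Type*} [TopologicalSpace M] [ChartedSpace E M]
  {E' : Type*} [NormedAddCommGroup E'] [NormedSpace ℂ E']
  {M' : Type*} [TopologicalSpace M'] [ChartedSpace E' M']
  {E'' : Type*} [NormedAddCommGroup E''] [NormedSpace ℂ E'']
  {M'' : Type*} [TopologicalSpace M''] [ChartedSpace E'' M'']

lemma contMDiff_real_of_complex {n : ℕ∞ω} {f : M → M'}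
    (h : ContMDiff 𝓘(ℂ, E) 𝓘(ℂ, E') n f) : ContMDiff 𝓘(ℝ, E) 𝓘(ℝ, E') n f := by
  intro x
  have hx := contMDiffAt_iff.1 (h x)
  exact contMDiffAt_iff.2 ⟨hx.1, hx.2.restrict_scalars ℝ⟩

lemma contMDiff_prod_real_of_complex {n : ℕ∞ω} {f : M × M' → M''}
    (h : ContMDiff (𝓘(ℂ, E).prod 𝓘(ℂ, E')) 𝓘(ℂ, E'') n f) :
    ContMDiff (𝓘(ℝ, E).prod 𝓘(ℝ, E')) 𝓘(ℝ, E'') n f := by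
  intro x
  have hx := contMDiffAt_iff.1 (h x)
  exact contMDiffAt_iff.2 ⟨hx.1, hx.2.restrict_scalars ℝ⟩

lemma isManifold_real_of_complex {n : ℕ∞ω} [IsManifold 𝓘(ℂ, E) n M] : IsManifold 𝓘(ℝ, E) n M := by
  refine isManifold_of_contDiffOn _ _ _ fun e e' he he' => ?_
  have h := (contDiffGroupoid n 𝓘(ℂ, E)).compatible he he'
  rw [contDiffGroupoid, mem_groupoid_of_pregroupoid] at h
  exact ContDiffOn.restrict_scalars ℝ h.1

lemma exists_hasDiff_of_complex {f : M → M'} {x : M} (h : MDifferentiableAt 𝓘(ℂ, E) 𝓘(ℂ, E') f x) :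
    ∃ f' : E →L[ℂ] E', HasDiff f x (f'.restrictScalars ℝ) :=
  ⟨mfderiv 𝓘(ℂ, E) 𝓘(ℂ, E') f x,
   h.hasMFDerivAt.1, h.hasMFDerivAt.2.restrictScalars ℝ⟩

lemma HasDiff.map_I_smul {f : M → M'} {x : M} {f' : E →L[ℝ] E'} (hf : HasDiff f x f')
    (h : MDifferentiableAt 𝓘(ℂ, E) 𝓘(ℂ, E') f x) (v : E) :
    f' (Complex.I • v) = Complex.I • f' v := by
  obtain ⟨f'', h'⟩ := exists_hasDiff_of_complex h
  rw [hf.unique h']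
  exact f''.map_smul Complex.I v

lemma lieGroup_real_of_complex {n : ℕ∞ω} [Group M] [LieGroup 𝓘(ℂ, E) n M] :
    LieGroup 𝓘(ℝ, E) n M where
  toIsManifold := isManifold_real_of_complex
  contMDiff_mul := contMDiff_prod_real_of_complex (contMDiff_mul 𝓘(ℂ, E) n)
  contMDiff_inv := contMDiff_real_of_complex (contMDiff_inv 𝓘(ℂ, E) n)

end RestrictScalars

/-! ### One-parameter subgroups -/

section OneParameter

variable {E : Type*} [NormedAddCommGroup E] [NormedSpace ℝ E]
  {G : Type*} [Group G] [TopologicalSpace G] [ChartedSpace E G] [LieGroup 𝓘(ℝ, E) ∞ G]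

lemma exists_hasDiff_mul_left (a b : G) :
    ∃ f' : E →L[ℝ] E, HasDiff (fun x : G => a * x) b f' :=
  (contMDiff_mul_left (I := 𝓘(ℝ, E)) (n := ∞) (a := a)).exists_hasDiff (by simp) b

lemma exists_hasDiff_mul_right (a b : G) :
    ∃ f' : E →L[ℝ] E, HasDiff (fun x : G => x * a) b f' :=
  (contMDiff_mul_right (I := 𝓘(ℝ, E)) (n := ∞) (a := a)).exists_hasDiff (by simp) b

/-- Left translates of integral curves of a left-invariant vector field are integral curves. -/
lemma isMIntegralCurveOn_const_mul {v : GroupLieAlgebra 𝓘(ℝ, E) G} {γ : ℝ → G} {s : Set ℝ}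
    (hγ : IsMIntegralCurveOn γ (mulInvariantVectorField v) s) (g : G) :
    IsMIntegralCurveOn (fun t => g * γ t) (mulInvariantVectorField v) s := by
  intro t ht
  obtain ⟨f₁, h₁⟩ := exists_hasDiff_mul_left (E := E) g (γ t)
  obtain ⟨f₂, h₂⟩ := exists_hasDiff_mul_left (E := E) (γ t) 1
  have h3 : HasDiff (fun x : G => g * γ t * x) 1 (f₁.comp f₂) :=
    (h₁.comp h₂ (mul_one _)).congr fun z => mul_assoc _ _ _
  have e1 : (mulInvariantVectorField v (γ t) : E) = f₂ v := DFunLike.congr_fun h₂.mfderiv_eq v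
  have e2 : (mulInvariantVectorField v (g * γ t) : E) = f₁ (f₂ v) :=
    DFunLike.congr_fun h3.mfderiv_eq v
  have h1 := HasMFDerivAt.comp_hasMFDerivWithinAt t h₁ (hγ t ht)
  have e3 : (1 : ℝ →L[ℝ] ℝ).smulRight (mulInvariantVectorField v (g * γ t) : E) =
      f₁.comp ((1 : ℝ →L[ℝ] ℝ).smulRight (mulInvariantVectorField v (γ t) : E)) := by
    rw [e1, e2]
    exact ContinuousLinearMap.ext fun u => (f₁.map_smul u (f₂ v)).symm
  exact e3 ▸ h1

/-- The one-parameter subgroup with a given velocity. It is the integral curve through `1` of the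
left-invariant vector field, which is complete since left translates of one solution near `0` are
solutions of the same length everywhere. -/
theorem exists_oneParameter [CompleteSpace E] [T2Space G] (v : E) :
    ∃ γ : ℝ → G, γ 0 = 1 ∧ (∀ s t, γ (s + t) = γ s * γ t) ∧ HasVel γ 0 v := by
  have : LieGroup 𝓘(ℝ, E) (minSmoothness ℝ 3) G := by
    rw [minSmoothness_of_isRCLikeNormedField]
    exact LieGroup.of_le (n := ∞) ENat.LEInfty.out
  have : IsManifold 𝓘(ℝ, E) 1 G := IsManifold.of_le (n := ∞) (by simp)
  have hv : ContMDiff 𝓘(ℝ, E) 𝓘(ℝ, E).tangent 1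
      (fun g : G => (⟨g, mulInvariantVectorField (I := 𝓘(ℝ, E)) (G := G) v g⟩ :
        TangentBundle 𝓘(ℝ, E) G)) :=
    (contMDiff_mulInvariantVectorField (I := 𝓘(ℝ, E)) (G := G) v).of_le
      (by rw [minSmoothness_of_isRCLikeNormedField]; norm_num)
  obtain ⟨γ₀, h0, hγ₀⟩ := exists_isMIntegralCurveAt_of_contMDiffAt_boundaryless (t₀ := 0)
    (hv 1)
  obtain ⟨ε, hε, hγε⟩ := isMIntegralCurveAt_iff'.1 hγ₀
  obtain ⟨γ, hγ0, hγ⟩ := exists_isMIntegralCurve_of_isMIntegralCurveOn hv hε (fun g =>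
    ⟨fun t => g * γ₀ t, by simp [h0], by
      have := isMIntegralCurveOn_const_mul hγε g
      simpa [Real.ball_eq_Ioo] using this⟩) (1 : G)
  refine ⟨γ, hγ0, fun s t => ?_, ?_⟩
  · have h1 : IsMIntegralCurve (γ ∘ (· + s))
        (mulInvariantVectorField (I := 𝓘(ℝ, E)) (G := G) v) := hγ.comp_add s
    have h2 : IsMIntegralCurve (fun t => γ s * γ t)
        (mulInvariantVectorField (I := 𝓘(ℝ, E)) (G := G) v) := by
      rw [isMIntegralCurve_iff_isMIntegralCurveOn] at hγ ⊢
      exact isMIntegralCurveOn_const_mul hγ (γ s)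
    have h3 := isMIntegralCurve_Ioo_eq_of_contMDiff_boundaryless (t₀ := 0) hv h1 h2 (by simp [hγ0])
    have := congrFun h3 t
    simpa [add_comm] using this
  · have h2 : (mulInvariantVectorField (I := 𝓘(ℝ, E)) (G := G) v (γ 0) : E) = v := by
      rw [hγ0]
      have h3 : HasDiff (E := E) (E' := E) (fun x : G => 1 * x) 1 (ContinuousLinearMap.id ℝ E) :=
        (hasDiff_id (E := E) (1 : G)).congr fun z => one_mul z
      exact DFunLike.congr_fun h3.mfderiv_eq v
    have h1 := hγ 0
    have h4 : HasVel (E := E) γ 0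
        (mulInvariantVectorField (I := 𝓘(ℝ, E)) (G := G) v (γ 0) : E) := h1
    rwa [h2] at h4

end OneParameter

/-! ### The exponential map of a linear complexification -/

/-- A complexification `ι : K → G` with the differentials at `1` that its definition provides: `dρ`
is the differential of a faithful holomorphic representation `ρ`, unitary on `K`, and `L` is the map
`𝔨 → 𝔤` of Lie algebras. The map `π` is a left inverse of `(a, b) ↦ dρ (L a + 𝐢 L b)`. -/
structure LinearModel {EK : Type*} [NormedAddCommGroup EK] [NormedSpace ℝ EK]
    {K : Type*} [Group K] [TopologicalSpace K] [ChartedSpace EK K]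
    {EG : Type*} [NormedAddCommGroup EG] [NormedSpace ℂ EG]
    {G : Type*} [Group G] [TopologicalSpace G] [ChartedSpace EG G]
    (ι : K →* G) (A : Type*) [CStarAlgebra A] where
  ρ : G →* A
  dρ : EG →L[ℂ] A
  L : EK →L[ℝ] EG
  π : A →L[ℝ] EK × EK
  injective_ρ : Function.Injective ρ
  contMDiff_ρ : ContMDiff 𝓘(ℝ, EG) 𝓘(ℝ, A) 1 (fun g : G => ρ g)
  hasDiff_ρ : HasDiff (fun g : G => ρ g) 1 (dρ.restrictScalars ℝ)
  continuous_ι : Continuous ι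
  hasDiff_ι : HasDiff (fun k : K => ι k) 1 L
  exists_eq : ∀ w, ∃ a b, w = L a + Complex.I • L b
  π_dρ : ∀ a b, π (dρ (L a + Complex.I • L b)) = (a, b)
  star_ρ_ι : ∀ k, star (ρ (ι k)) * ρ (ι k) = 1

section RepresentedGroup

variable {E : Type*} [NormedAddCommGroup E] [NormedSpace ℝ E]
  {G : Type*} [Group G] [TopologicalSpace G] [ChartedSpace E G]
  {A : Type*} [CStarAlgebra A] {ρ : G →* A} {d : E →L[ℝ] A}

/-- A representation maps one-parameter subgroups to exponentials. -/
lemma ρ_oneParameter (hρ : HasDiff (fun g : G => ρ g) 1 d) {γ : ℝ → G} {v : E} (h0 : γ 0 = 1)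
    (hadd : ∀ s t, γ (s + t) = γ s * γ t) (hv : HasVel γ 0 v) (t : ℝ) :
    ρ (γ t) = exp (t • d v) := by
  refine eq_exp_smul_of_hasDerivAt (γ := fun t => ρ (γ t)) (by simp [h0])
    (fun s t => by simp [hadd]) ?_ t
  exact hasVel_iff_hasDerivAt.1 (hρ.comp_hasVel hv h0)

variable [CompleteSpace E] [T2Space G] [LieGroup 𝓘(ℝ, E) ∞ G]

/-- The differential of a faithful representation is injective. -/
lemma injective_of_injective_ρ (hρ : HasDiff (fun g : G => ρ g) 1 d)
    (hinj : Function.Injective ρ) : Function.Injective d := by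
  rw [injective_iff_map_eq_zero]
  intro v hv
  obtain ⟨γ, h0, hadd, hγ⟩ := exists_oneParameter (G := G) v
  have h1 : ∀ t, γ t = 1 := fun t => hinj (by
    rw [ρ_oneParameter hρ h0 hadd hγ, hv]; simp)
  have h2 : HasVel γ 0 ((0 : ℝ →L[ℝ] E) 1) := ((hasDiff_const (1 : G) (0 : ℝ)).congr h1).hasVel
  simpa using hγ.unique h2

/-- The one-parameter subgroup chosen in the definition of `lieExp v` exists, and `ρ` maps it to
`t ↦ exp (t • d v)`. -/
lemma ρ_lieExp (hρ : HasDiff (fun g : G => ρ g) 1 d) (v : E) :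
    ρ (lieExp (E := E) (G := G) v) = exp (d v) := by
  have h : ∃ γ : ℝ → G, γ 0 = 1 ∧ (∀ s t, γ (s + t) = γ s * γ t) ∧
      MDifferentiableAt 𝓘(ℝ, ℝ) 𝓘(ℝ, E) γ 0 ∧
      (mfderiv 𝓘(ℝ, ℝ) 𝓘(ℝ, E) γ 0 (1 : ℝ) : E) = v := by
    obtain ⟨γ, h0, hadd, hγ⟩ := exists_oneParameter (G := G) v
    refine ⟨γ, h0, hadd, HasDiff.mdifferentiableAt hγ, ?_⟩
    exact (DFunLike.congr_fun (HasDiff.mfderiv_eq hγ) (1 : ℝ)).trans (one_smul ℝ v)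
  have hexp : lieExp (E := E) (G := G) v = h.choose 1 := dif_pos h
  rw [hexp]
  obtain ⟨h0, hadd, hd, hv⟩ := h.choose_spec
  have hvel : HasVel h.choose 0 v := hd.hasDiff.hasVel.of_eq hv
  have := ρ_oneParameter hρ h0 hadd hvel 1
  simpa using this

lemma hasVel_lieExp (hρ : HasDiff (fun g : G => ρ g) 1 d) (hinj : Function.Injective ρ) (v : E) :
    HasVel (fun t : ℝ => (lieExp (E := E) (G := G) (t • v) : G)) 0 v := by
  obtain ⟨γ, h0, hadd, hγ⟩ := exists_oneParameter (G := G) v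
  refine hγ.congr fun t => hinj ?_
  have h1 := ρ_lieExp hρ (t • v)
  rw [ρ_oneParameter hρ h0 hadd hγ, ← d.map_smul]
  exact h1

end RepresentedGroup

namespace LinearModel

variable {EK : Type*} [NormedAddCommGroup EK] [NormedSpace ℝ EK]
  {K : Type*} [Group K] [TopologicalSpace K] [ChartedSpace EK K]
  {EG : Type*} [NormedAddCommGroup EG] [NormedSpace ℂ EG]
  {G : Type*} [Group G] [TopologicalSpace G] [ChartedSpace EG G]
  {ι : K →* G} {A : Type*} [CStarAlgebra A] (D : LinearModel (EK := EK) (EG := EG) ι A)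

/-- The isomorphism `(a, b) ↦ a + 𝐢 b` from `𝔨 × 𝔨` to `𝔤`. -/
noncomputable def Λ : EK × EK →L[ℝ] EG :=
  D.L.comp (ContinuousLinearMap.fst ℝ EK EK) +
    (Complex.I • D.L).comp (ContinuousLinearMap.snd ℝ EK EK)

/-- The composite `𝔨 → 𝔤 → A`. -/
noncomputable def T : EK →L[ℝ] A := (D.dρ.restrictScalars ℝ).comp D.L

/-- The exponential map of `G` in the coordinates `(a, b) ↦ a + 𝐢 b` of `𝔤`. -/
noncomputable def e (p : EK × EK) : G := lieExp (E := EG) (G := G) (D.Λ p)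

lemma Λ_apply (p : EK × EK) : D.Λ p = D.L p.1 + Complex.I • D.L p.2 := rfl

lemma T_apply (a : EK) : D.T a = D.dρ (D.L a) := rfl

lemma dρ_Λ (p : EK × EK) : D.dρ (D.Λ p) = D.T p.1 + Complex.I • D.T p.2 := by
  rw [Λ_apply, map_add, map_smul]; rfl

lemma π_dρ_Λ (p : EK × EK) : D.π (D.dρ (D.Λ p)) = p := D.π_dρ p.1 p.2

lemma fst_π_T (a : EK) : (D.π (D.T a)).1 = a := by
  have := D.π_dρ_Λ (a, 0)
  rw [dρ_Λ] at this
  simp only [map_zero, smul_zero, add_zero] at this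
  rw [this]

lemma T_fst_π_T (a : EK) : D.T (D.π (D.T a)).1 = D.T a := by
  rw [fst_π_T]

lemma exists_eq_Λ (w : EG) : ∃ p, w = D.Λ p := by
  obtain ⟨a, b, h⟩ := D.exists_eq w
  exact ⟨(a, b), h⟩

lemma Λ_π_dρ (w : EG) : D.Λ (D.π (D.dρ w)) = w := by
  obtain ⟨p, rfl⟩ := D.exists_eq_Λ w
  rw [π_dρ_Λ]

/-- The map `π ∘ ρ : G → 𝔨 × 𝔨` in the chart at `1`. -/
noncomputable def chartMap (y : EG) : EK × EK := D.π (D.ρ ((chartAt EG (1 : G)).symm y))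

lemma contDiffAt_chartMap : ContDiffAt ℝ 1 D.chartMap (chartAt EG (1 : G) 1) := by
  have h := (contMDiffAt_iff.1 (D.contMDiff_ρ 1)).2
  have h1 : ContDiffAt ℝ 1 (fun y : EG => D.ρ ((chartAt EG (1 : G)).symm y))
      (chartAt EG (1 : G) 1) := by
    rw [← contDiffWithinAt_univ]
    simp only [mfld_simps] at h
    exact h
  exact D.π.contDiff.contDiffAt.comp _ h1

lemma hasFDerivAt_chartMap : HasFDerivAt D.chartMap
    (D.π.comp (D.dρ.restrictScalars ℝ)) (chartAt EG (1 : G) 1) := by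
  have h := D.hasDiff_ρ.2
  have h1 : HasFDerivAt (fun y : EG => D.ρ ((chartAt EG (1 : G)).symm y))
      (D.dρ.restrictScalars ℝ) (chartAt EG (1 : G) 1) := by
    rw [← hasFDerivWithinAt_univ]
    simp only [mfld_simps] at h
    exact h
  exact D.π.hasFDerivAt.comp _ h1

/-- The inverse `π ∘ dρ` of `Λ`, as an isomorphism. -/
noncomputable def ΛEquiv : EG ≃L[ℝ] (EK × EK) :=
  ContinuousLinearEquiv.equivOfInverse (D.π.comp (D.dρ.restrictScalars ℝ)) D.Λ
    (fun w => D.Λ_π_dρ w) (fun p => D.π_dρ_Λ p)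

lemma hasFDerivAt_chartMap' : HasFDerivAt D.chartMap
    (D.ΛEquiv : EG →L[ℝ] (EK × EK)) (chartAt EG (1 : G) 1) :=
  D.hasFDerivAt_chartMap

lemma chartMap_one : D.chartMap (chartAt EG (1 : G) 1) = D.π 1 := by
  simp [chartMap]

variable [CompleteSpace EG]

/-- The local inverse of `π ∘ ρ : G → 𝔨 × 𝔨` near `1`. -/
noncomputable def sec (p : EK × EK) : G :=
  (chartAt EG (1 : G)).symm
    (D.contDiffAt_chartMap.localInverse D.hasFDerivAt_chartMap' (by simp) p)

lemma sec_one : D.sec (D.π 1) = 1 := by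
  have := D.contDiffAt_chartMap.localInverse_apply_image D.hasFDerivAt_chartMap' (by simp)
  rw [chartMap_one] at this
  rw [sec, this]
  simp

lemma eventually_sec_eq : ∀ᶠ g in 𝓝 (1 : G), D.sec (D.π (D.ρ g)) = g := by
  have h1 : ∀ᶠ y in 𝓝 (chartAt EG (1 : G) 1),
      D.contDiffAt_chartMap.localInverse D.hasFDerivAt_chartMap' (by simp) (D.chartMap y) = y :=
    HasStrictFDerivAt.eventually_left_inverse _
  have h2 : Filter.Tendsto (chartAt EG (1 : G)) (𝓝 1) (𝓝 (chartAt EG (1 : G) 1)) :=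
    (chartAt EG (1 : G)).continuousAt (by simp)
  filter_upwards [h2 h1, (chartAt EG (1 : G)).open_source.mem_nhds (by simp)] with g hg hs
  have h3 : D.chartMap (chartAt EG (1 : G) g) = D.π (D.ρ g) := by
    rw [chartMap, (chartAt EG (1 : G)).left_inv hs]
  rw [Set.mem_preimage, Set.mem_ofPred, h3] at hg
  rw [sec, hg, (chartAt EG (1 : G)).left_inv hs]

lemma exists_injOn : ∃ N ∈ 𝓝 (1 : G), Set.InjOn (fun g => D.π (D.ρ g)) N :=
  ⟨_, D.eventually_sec_eq, fun g hg h hh hgh => by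
    rw [← Set.mem_ofPred.1 hg, ← Set.mem_ofPred.1 hh]
    exact congrArg D.sec hgh⟩

variable [LieGroup 𝓘(ℝ, EG) ∞ G]

lemma contMDiffAt_sec : ContMDiffAt 𝓘(ℝ, EK × EK) 𝓘(ℝ, EG) 1 D.sec (D.π 1) := by
  have h0 : IsManifold 𝓘(ℝ, EG) 1 G := IsManifold.of_le (n := ∞) (by simp)
  have h1 := D.contDiffAt_chartMap.to_localInverse D.hasFDerivAt_chartMap' (by simp)
  have h2 := D.contDiffAt_chartMap.localInverse_apply_image D.hasFDerivAt_chartMap' (by simp)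
  rw [chartMap_one] at h1 h2
  have h3 : ContMDiffAt 𝓘(ℝ, EG) 𝓘(ℝ, EG) 1 (chartAt EG (1 : G)).symm (chartAt EG (1 : G) 1) := by
    have := contMDiffOn_chart_symm (I := 𝓘(ℝ, EG)) (n := 1) (x := (1 : G))
    exact this.contMDiffAt ((chartAt EG (1 : G)).open_target.mem_nhds (by simp))
  rw [← h2] at h3
  exact h3.comp _ h1.contMDiffAt

variable [T2Space G]

lemma ρ_e (p : EK × EK) : D.ρ (D.e p) = exp (D.T p.1 + Complex.I • D.T p.2) := by
  rw [← D.dρ_Λ]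
  exact ρ_lieExp D.hasDiff_ρ (D.Λ p)

lemma e_add_smul (p : EK × EK) (t t' : ℝ) : D.e ((t + t') • p) = D.e (t • p) * D.e (t' • p) := by
  apply D.injective_ρ
  rw [map_mul, ρ_e, ρ_e, ρ_e, ← D.dρ_Λ, ← D.dρ_Λ, ← D.dρ_Λ, ← exp_add_comm']
  · rw [add_smul, map_add, map_add]
  · have : ∀ t : ℝ, D.dρ (D.Λ (t • p)) = t • D.dρ (D.Λ p) := fun t => by
      rw [map_smul]; exact (D.dρ.restrictScalars ℝ).map_smul t _
    rw [this, this]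
    exact ((Commute.refl _).smul_left t).smul_right t'

lemma e_zero : D.e 0 = 1 := D.injective_ρ (by simp [ρ_e])

lemma e_eq_pow (p : EK × EK) (n : ℕ) : D.e ((n : ℝ) • p) = D.e p ^ n := by
  induction n with
  | zero => simp [e_zero]
  | succ n ih =>
    rw [pow_succ, ← ih]
    have := D.e_add_smul p n 1
    simpa using this

lemma hasVel_e (p : EK × EK) : HasVel (fun t : ℝ => D.e (t • p)) 0 (D.Λ p) := by
  refine (hasVel_lieExp D.hasDiff_ρ D.injective_ρ (D.Λ p)).congr fun t => ?_
  rw [e, map_smul]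

lemma hasDerivAt_ρ_e (p : EK × EK) : HasDerivAt (fun t : ℝ => D.ρ (D.e (t • p)))
    (D.dρ (D.Λ p)) 0 :=
  hasVel_iff_hasDerivAt.1 (D.hasDiff_ρ.comp_hasVel (D.hasVel_e p) (by simp [e_zero]))

lemma continuous_e_smul (p : EK × EK) : Continuous fun t : ℝ => D.e (t • p) := by
  have : IsTopologicalGroup G := topologicalGroup_of_lieGroup 𝓘(ℝ, EG) ∞
  refine continuous_iff_continuousAt.2 fun t => ?_
  have h1 : ContinuousAt (fun u : ℝ => D.e (u • p)) 0 := HasDiff.continuousAt (D.hasVel_e p)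
  have h2 : ContinuousAt (fun u : ℝ => D.e (t • p) * D.e ((u - t) • p)) t := by
    refine continuousAt_const.mul ?_
    have h3 : ContinuousAt (fun u : ℝ => D.e (u • p)) (t - t) := by simpa using h1
    exact ContinuousAt.comp (f := fun u : ℝ => u - t) h3 (by fun_prop)
  refine h2.congr (Filter.Eventually.of_forall fun u => ?_)
  simp only [← e_add_smul, add_sub_cancel]

/-- Near `0` the exponential map of `G` is obtained from that of `A` through `sec`: on the ray
through `p` both sides are curves in `G` with the same image under the locally injective map
`π ∘ ρ`, so that they agree on `[0, 1]` by connectedness. -/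
lemma eventually_e_eq_sec : ∀ᶠ p in 𝓝 (0 : EK × EK), D.e p = D.sec (D.π (exp (D.dρ (D.Λ p)))) := by
  obtain ⟨N, hN, hNo, h1N⟩ := mem_nhds_iff.1 D.eventually_sec_eq
  have hcont : ∀ᶠ q in 𝓝 (D.π 1), ContinuousAt D.sec q := by
    have h0 : IsManifold 𝓘(ℝ, EG) 1 G := IsManifold.of_le (n := ∞) (by simp)
    have := (contMDiffAt_iff_contMDiffAt_nhds (by simp)).1 D.contMDiffAt_sec
    exact this.mono fun q hq => hq.continuousAt
  have hmem : ∀ᶠ q in 𝓝 (D.π 1), D.sec q ∈ N := by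
    have := D.contMDiffAt_sec.continuousAt
    rw [ContinuousAt, sec_one] at this
    exact this (hNo.mem_nhds h1N)
  set f : EK × EK → EK × EK := fun p => D.π (exp (D.dρ (D.Λ p))) with hf
  have hfc : Continuous f := D.π.continuous.comp
    (contDiff_exp_cstar.continuous.comp (D.dρ.continuous.comp D.Λ.continuous))
  have hf0 : Filter.Tendsto f (𝓝 0) (𝓝 (D.π 1)) := by
    have := hfc.tendsto 0
    simpa [hf] using this
  obtain ⟨δ, hδ, hball⟩ := Metric.eventually_nhds_iff_ball.1 (hf0 (hcont.and hmem))
  filter_upwards [Metric.ball_mem_nhds 0 hδ] with p hp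
  have hseg : ∀ t ∈ Set.Icc (0 : ℝ) 1, ContinuousAt D.sec (f (t • p)) ∧ D.sec (f (t • p)) ∈ N := by
    intro t ht
    refine hball _ ?_
    rw [mem_ball_zero_iff] at hp ⊢
    rw [norm_smul, Real.norm_of_nonneg ht.1]
    nlinarith [norm_nonneg p, ht.2]
  have hρf : ∀ t : ℝ, f (t • p) = D.π (D.ρ (D.e (t • p))) := fun t => by
    rw [ρ_e, ← dρ_Λ]
  set c : ℝ → G := fun t => D.sec (f (t • p)) with hc
  have hcc : ContinuousOn c (Set.Icc 0 1) := fun t ht =>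
    ((hseg t ht).1.comp (f := fun t : ℝ => f (t • p)) (by fun_prop)).continuousWithinAt
  have hec := D.continuous_e_smul p
  have hclosed : IsClosed ({t : ℝ | D.e (t • p) = c t} ∩ Set.Icc 0 1) := by
    have := (hec.continuousOn.prodMk hcc).preimage_isClosed_of_isClosed isClosed_Icc
      (isClosed_diagonal (X := G))
    rwa [Set.inter_comm] at this
  have hsub := hclosed.Icc_subset_of_forall_mem_nhdsWithin (a := 0) (b := 1)
    (by simp [hc, hf, e_zero, sec_one]) (fun t ht => by
      have h1 : D.e (t • p) ∈ N := by
        rw [Set.mem_ofPred.1 ht.1]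
        exact (hseg t ⟨ht.2.1, ht.2.2.le⟩).2
      have h2 : ∀ᶠ u in 𝓝 t, D.e (u • p) ∈ N := hec.continuousAt (hNo.mem_nhds h1)
      refine mem_nhdsWithin_of_mem_nhds ?_
      filter_upwards [h2] with u hu
      change D.e (u • p) = D.sec (f (u • p))
      rw [hρf]
      exact (hN hu).symm)
  have := hsub (Set.right_mem_Icc.2 zero_le_one)
  simpa [hc] using this

/-- The exponential map of `G` is continuously differentiable: near `0` by the preceding lemma, and
everywhere since `exp p = exp (p / n) ^ n`. -/
lemma contMDiff_e : ContMDiff 𝓘(ℝ, EK × EK) 𝓘(ℝ, EG) 1 D.e := by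
  have hLG : LieGroup 𝓘(ℝ, EG) 1 G := LieGroup.of_le (n := ∞) (by simp)
  have h0 : ContMDiffAt 𝓘(ℝ, EK × EK) 𝓘(ℝ, EG) 1 D.e 0 := by
    have hf : ContDiff ℝ 1 fun p : EK × EK => D.π (exp (D.dρ (D.Λ p))) :=
      D.π.contDiff.comp ((contDiff_exp_cstar.of_le (by simp)).comp
        ((D.dρ.restrictScalars ℝ).contDiff.comp D.Λ.contDiff))
    have h1 : ContMDiffAt 𝓘(ℝ, EK × EK) 𝓘(ℝ, EG) 1
        (fun p : EK × EK => D.sec (D.π (exp (D.dρ (D.Λ p))))) 0 := by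
      have h2 := D.contMDiffAt_sec
      have h3 : D.π 1 = D.π (exp (D.dρ (D.Λ 0))) := by simp
      rw [h3] at h2
      exact ContMDiffAt.comp (g := D.sec) (0 : EK × EK) h2 hf.contMDiff.contMDiffAt
    exact h1.congr_of_eventuallyEq D.eventually_e_eq_sec
  have h1 := (contMDiffAt_iff_contMDiffAt_nhds (by simp)).1 h0
  intro p
  have h2 : Filter.Tendsto (fun n : ℕ => ((n : ℝ)⁻¹) • p) Filter.atTop (𝓝 0) := by
    have h3 := ((tendsto_inv_atTop_zero (𝕜 := ℝ)).comp tendsto_natCast_atTop_atTop).smul_const p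
    rwa [zero_smul] at h3
  obtain ⟨n, hn, hn0⟩ := ((h2.eventually h1).and (Filter.eventually_ne_atTop 0)).exists
  have hn0' : (n : ℝ) ≠ 0 := by exact_mod_cast hn0
  have h3 : D.e = fun q => D.e ((n : ℝ)⁻¹ • q) ^ n := by
    funext q
    rw [← e_eq_pow, smul_smul, mul_inv_cancel₀ hn0', one_smul]
  rw [h3]
  have h4 : ContMDiffAt 𝓘(ℝ, EK × EK) 𝓘(ℝ, EG) 1 (fun q : EK × EK => D.e ((n : ℝ)⁻¹ • q)) p := by
    have h5 : ContMDiffAt 𝓘(ℝ, EK × EK) 𝓘(ℝ, EK × EK) 1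
        (fun q : EK × EK => (n : ℝ)⁻¹ • q) p :=
      (contDiff_const_smul (n : ℝ)⁻¹).contMDiff.contMDiffAt
    exact ContMDiffAt.comp p (g := D.e) hn h5
  exact ContMDiffAt.comp (g := fun g : G => g ^ n) p (contMDiff_pow n _) h4

/-- The curve `t ↦ exp (𝐢 (s + t r)) exp (- 𝐢 s)` in `G` has a velocity at `t = 0`, which `dρ` maps
to the logarithmic differential of the exponential map of `A`. -/
lemma exists_hasVel_E (s r : EK) : ∃ a b,
    HasVel (fun t : ℝ => D.e (0, s + t • r) * (D.e (0, s))⁻¹) 0 (D.Λ (a, b)) ∧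
    dexp (Complex.I • D.T s) (Complex.I • D.T r) * exp (-(Complex.I • D.T s)) =
      D.T a + Complex.I • D.T b := by
  obtain ⟨f₁, h₁⟩ := D.contMDiff_e.exists_hasDiff (by simp) ((0, s) : EK × EK)
  obtain ⟨f₂, h₂⟩ := exists_hasDiff_mul_right (E := EG) (D.e (0, s))⁻¹ (D.e (0, s))
  have hc : HasVel (fun t : ℝ => ((0 : EK), s + t • r)) 0 ((0 : EK), r) := by
    rw [hasVel_iff_hasDerivAt]
    have h1 : HasDerivAt (fun t : ℝ => s + t • r) r 0 := by
      simpa using ((hasDerivAt_id (0 : ℝ)).smul_const r).const_add s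
    exact (hasDerivAt_const (0 : ℝ) (0 : EK)).prodMk h1
  have hv : HasVel (fun t : ℝ => D.e (0, s + t • r) * (D.e (0, s))⁻¹) 0 (f₂ (f₁ ((0 : EK), r))) :=
    h₂.comp_hasVel (h₁.comp_hasVel hc (by simp)) (by simp)
  obtain ⟨⟨a, b⟩, hab⟩ := D.exists_eq_Λ (f₂ (f₁ ((0 : EK), r)))
  rw [hab] at hv
  refine ⟨a, b, hv, ?_⟩
  have h3 := hasVel_iff_hasDerivAt.1 (D.hasDiff_ρ.comp_hasVel hv (by simp))
  have hinv : D.ρ (D.e (0, s))⁻¹ = exp (-(Complex.I • D.T s)) := by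
    have h4 : D.ρ (D.e (0, s))⁻¹ * exp (Complex.I • D.T s) = 1 := by
      have := D.ρ_e (0, s)
      simp only [map_zero, zero_add] at this
      rw [← this, ← map_mul]; simp
    calc _ = D.ρ (D.e (0, s))⁻¹ * (exp (Complex.I • D.T s) * exp (-(Complex.I • D.T s))) := by simp
      _ = _ := by rw [← mul_assoc, h4, one_mul]
  have h5 := (hasDerivAt_exp_line (Complex.I • D.T s) (Complex.I • D.T r)).mul_const
    (exp (-(Complex.I • D.T s)))
  have h6 := h3.unique (h5.congr_of_eventuallyEq (Filter.Eventually.of_forall fun t => by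
    simp only
    rw [map_mul, hinv, ρ_e]
    simp [smul_comm t Complex.I]))
  rw [← h6]
  exact D.dρ_Λ (a, b)

variable [CompleteSpace EK] [LieGroup 𝓘(ℝ, EK) ∞ K] [T2Space K]

/-- The one-parameter subgroup of `a ∈ 𝔨` in `K` lies over that in `G`. -/
lemma exists_oneParameter_K (a : EK) : ∃ γ : ℝ → K, γ 0 = 1 ∧ HasVel γ 0 a ∧
    ∀ t : ℝ, ι (γ t) = D.e (t • a, 0) := by
  obtain ⟨γ, h0, hadd, hγ⟩ := exists_oneParameter (G := K) a
  refine ⟨γ, h0, hγ, fun t => D.injective_ρ ?_⟩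
  have h1 : HasVel (fun t => ι (γ t)) 0 (D.L a) := D.hasDiff_ι.comp_hasVel hγ h0
  rw [ρ_oneParameter (γ := fun t => ι (γ t)) D.hasDiff_ρ (by simp [h0])
    (fun s t => by simp [hadd]) h1, ρ_e]
  simp [T_apply]

lemma star_T (a : EK) : star (D.T a) = -D.T a := by
  obtain ⟨γ, h0, -, hγ⟩ := D.exists_oneParameter_K a
  have h1 : HasDerivAt (fun t : ℝ => D.ρ (D.e (t • (a, (0 : EK))))) (D.T a) 0 := by
    have := D.hasDerivAt_ρ_e (a, 0)
    rwa [dρ_Λ, map_zero, smul_zero, add_zero] at this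
  have h2 := h1.star.mul h1
  have h3 : ((fun t : ℝ => star (D.ρ (D.e (t • (a, (0 : EK)))))) *
      fun t : ℝ => D.ρ (D.e (t • (a, (0 : EK))))) = fun _ => 1 := by
    funext t
    have h4 : t • (a, (0 : EK)) = (t • a, 0) := by simp
    simp only [Pi.mul_apply]
    rw [h4, ← hγ t, D.star_ρ_ι]
  rw [h3] at h2
  have h5 := h2.unique (hasDerivAt_const (0 : ℝ) (1 : A))
  simp only [zero_smul, e_zero, map_one, star_one, mul_one, one_mul] at h5
  exact eq_neg_of_add_eq_zero_left h5

/-- `Ad k` on `𝔨` is conjugation by `ρ (ι k)` in the representation. -/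
lemma T_Ad (k : K) (s : EK) : D.T (Ad (EK := EK) k s) = D.ρ (ι k) * D.T s * D.ρ (ι k⁻¹) := by
  obtain ⟨f₁, h₁⟩ := exists_hasDiff_mul_left (E := EK) k (1 : K)
  obtain ⟨f₂, h₂⟩ := exists_hasDiff_mul_right (E := EK) k⁻¹ k
  have h3 : HasDiff (fun x : K => k * x * k⁻¹) 1 (f₂.comp f₁) := h₂.comp h₁ (mul_one k)
  have h4 : (Ad (EK := EK) k s : EK) = f₂ (f₁ s) := DFunLike.congr_fun h3.mfderiv_eq s
  rw [h4]
  obtain ⟨γ, h0, hγ, -⟩ := D.exists_oneParameter_K s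
  have hρι : HasDiff (fun x : K => D.ρ (ι x)) 1 D.T := D.hasDiff_ρ.comp D.hasDiff_ι (map_one ι)
  have h5 : HasVel (fun t => k * γ t * k⁻¹) 0 (f₂ (f₁ s)) := h3.comp_hasVel hγ h0
  have h6 := hasVel_iff_hasDerivAt.1 (hρι.comp_hasVel h5 (by simp [h0]))
  have h7 := hasVel_iff_hasDerivAt.1 (hρι.comp_hasVel hγ h0)
  have h8 := (h7.const_mul (D.ρ (ι k))).mul_const (D.ρ (ι k⁻¹))
  refine h6.unique (h8.congr_of_eventuallyEq (Filter.Eventually.of_forall fun t => ?_))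
  simp

/-- The polar decomposition data of a linear complexification. -/
noncomputable def polarData : PolarData K G EK A where
  ι := ι
  ρ := D.ρ
  T := D.T
  e := D.e
  π := D.π
  Ad := fun k s => Ad (EK := EK) k s
  continuous_ι := D.continuous_ι
  continuous_ρ := D.contMDiff_ρ.continuous
  continuous_e := D.contMDiff_e.continuous
  injective_ρ := D.injective_ρ
  star_T := D.star_T
  π_apply a b := by
    have := D.π_dρ_Λ (a, b)
    rwa [dρ_Λ] at this
  ρ_e a b := D.ρ_e (a, b)
  star_ρ_ι := D.star_ρ_ι
  exists_ι_eq a := by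
    obtain ⟨γ, -, -, h⟩ := D.exists_oneParameter_K a
    exact ⟨γ 1, by simpa using h 1⟩
  exists_injOn := D.exists_injOn
  T_Ad := D.T_Ad
  exists_dexp_eq s r := by
    obtain ⟨a, b, -, h⟩ := D.exists_hasVel_E s r
    exact ⟨a, b, h⟩

end LinearModel

/-! ### Moment maps and orbits of the complexified group -/

section Orbit

variable {EG : Type*} [NormedAddCommGroup EG] [NormedSpace ℂ EG]
  {G : Type*} [Group G] [TopologicalSpace G] [ChartedSpace EG G]
  {E : Type*} [NormedAddCommGroup E] [NormedSpace ℂ E]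
  {F : Type*} [TopologicalSpace F] [ChartedSpace E F] [MulAction G F]

variable (EG G E) in
/-- The differential at `1` of the orbit map `g ↦ g p`. -/
noncomputable def orbitDiff (p : F) : EG →L[ℝ] E :=
  mfderiv 𝓘(ℝ, EG) 𝓘(ℝ, E) (fun g : G => g • p) 1

variable [ContMDiffSMul 𝓘(ℂ, EG) 𝓘(ℂ, E) ω G F]

lemma contMDiff_smul_const (p : F) : ContMDiff 𝓘(ℂ, EG) 𝓘(ℂ, E) ω fun g : G => g • p :=
  (contMDiff_smul (I := 𝓘(ℂ, EG)) (I' := 𝓘(ℂ, E)) (n := ω) (G := G) (M := F)).comp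
    (contMDiff_id.prodMk contMDiff_const)

lemma hasDiff_orbit (p : F) : HasDiff (fun g : G => g • p) 1 (orbitDiff EG G E p) :=
  (contMDiff_real_of_complex (contMDiff_smul_const p)).mdifferentiable (by simp) 1 |>.hasDiff

lemma orbitDiff_I_smul (p : F) (v : EG) :
    orbitDiff EG G E p (Complex.I • v) = Complex.I • orbitDiff EG G E p v :=
  (hasDiff_orbit p).map_I_smul ((contMDiff_smul_const p).mdifferentiable (by simp) 1) v

variable [IsManifold 𝓘(ℝ, E) 1 F] [T2Space F]

/-- A one-parameter group whose vector field vanishes at `p` fixes `p`: the orbit of `p` has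
velocity zero at all times, and so is an integral curve of the zero vector field. -/
lemma smul_eq_of_orbitDiff_eq_zero {γ : ℝ → G} (h0 : γ 0 = 1)
    (hadd : ∀ s t, γ (s + t) = γ s * γ t) {v : EG} (hγ : HasVel γ 0 v) {p : F}
    (hv : orbitDiff EG G E p v = 0) (t : ℝ) : γ t • p = p := by
  have h1 : ∀ t, HasVel (E := E) (fun u => γ u • p) t 0 := by
    intro t
    have hc : ContMDiff 𝓘(ℂ, E) 𝓘(ℂ, E) ω fun p : F => γ t • p :=
      (contMDiff_smul (I := 𝓘(ℂ, EG)) (I' := 𝓘(ℂ, E)) (n := ω) (G := G) (M := F)).comp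
        (contMDiff_const.prodMk contMDiff_id)
    obtain ⟨f, hf⟩ := (contMDiff_real_of_complex hc).exists_hasDiff (by simp) p
    have h2 : HasVel (E := E) (fun u => γ u • p) 0 0 :=
      ((hasDiff_orbit p).comp_hasVel hγ h0).of_eq hv
    have h3 : HasVel (E := E) (fun u => γ t • γ u • p) 0 0 :=
      (hf.comp_hasVel h2 (by simp [h0])).of_eq (map_zero f)
    have h4 : HasVel (fun u : ℝ => u - t) t (1 : ℝ) :=
      hasVel_iff_hasDerivAt.2 (by simpa using (hasDerivAt_id t).sub_const t)
    have h5 := (HasDiff.comp_hasVel h3 h4 (sub_self t)).congr (γ' := fun u => γ u • p)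
      fun u => by rw [smul_smul, ← hadd, add_sub_cancel]
    exact h5.of_eq (by simp)
  have hz : ContMDiff 𝓘(ℝ, E) 𝓘(ℝ, E).tangent 1
      (fun x : F => (⟨x, 0⟩ : TangentBundle 𝓘(ℝ, E) F)) :=
    Bundle.contMDiff_zeroSection ℝ (TangentSpace 𝓘(ℝ, E) (M := F))
  have h6 : IsMIntegralCurve (I := 𝓘(ℝ, E)) (fun u => γ u • p) (fun _ => 0) := h1
  have h7 : IsMIntegralCurve (I := 𝓘(ℝ, E)) (fun _ : ℝ => p) (fun _ => 0) := fun t =>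
    (hasDiff_const (E := ℝ) (E' := E) p t).hasVel.of_eq rfl
  exact congrFun (isMIntegralCurve_Ioo_eq_of_contMDiff_boundaryless (t₀ := 0) hz h6 h7
    (by simp [h0])) t

end Orbit

section Kahler

variable {E : Type*} [NormedAddCommGroup E] [NormedSpace ℂ E]
  {F : Type*} [TopologicalSpace F] [ChartedSpace E F] {Ω : TwoForm E F}

lemma IsKahlerForm.eq_zero (hΩ : IsKahlerForm Ω) {p : F} {v : TangentSpace 𝓘(ℝ, E) p}
    (h : Ω p ![v, complexStructure p v] = 0) : v = 0 := by
  by_contra h0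
  exact (hΩ.pos p _ h0).ne' h

lemma TwoForm.apply_zero_left (Ω : TwoForm E F) (p : F) (v : TangentSpace 𝓘(ℝ, E) p) :
    Ω p ![0, v] = 0 :=
  (Ω p).map_coord_zero 0 rfl

lemma IsKahlerForm.nonneg (hΩ : IsKahlerForm Ω) (p : F) (v : TangentSpace 𝓘(ℝ, E) p) :
    0 ≤ Ω p ![v, complexStructure p v] := by
  by_cases h0 : v = 0
  · rw [h0, Ω.apply_zero_left]
  · exact (hΩ.pos p _ h0).le

end Kahler

section DualMoment

variable {EK : Type*} [NormedAddCommGroup EK] [NormedSpace ℝ EK] [FiniteDimensional ℝ EK]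
  {K : Type*} [Group K] [TopologicalSpace K] [ChartedSpace EK K]
  {E : Type*} [NormedAddCommGroup E] [NormedSpace ℂ E]
  {F : Type*} [TopologicalSpace F] [ChartedSpace E F] [MulAction K F]
  {Ω : TwoForm E F} {μ : F → Module.Dual ℝ (TangentSpace 𝓘(ℝ, EK) (1 : K))}

variable (EK K) in
/-- The moment map with values in the continuous dual of the model space. -/
noncomputable def dualMoment (μ : F → Module.Dual ℝ (TangentSpace 𝓘(ℝ, EK) (1 : K))) (p : F) :
    EK →L[ℝ] ℝ :=
  LinearMap.toContinuousLinearMap (μ p : EK →ₗ[ℝ] ℝ)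

lemma contMDiff_dualMoment (hμ : IsMomentMap Ω μ) :
    ContMDiff 𝓘(ℝ, E) 𝓘(ℝ, EK →L[ℝ] ℝ) ∞ (dualMoment EK K μ) := by
  let b := Module.finBasis ℝ EK
  have h : dualMoment EK K μ = fun p => ∑ i, (dualMoment EK K μ p (b i)) •
      (LinearMap.toContinuousLinearMap (b.coord i) : EK →L[ℝ] ℝ) := by
    funext p
    ext s
    calc dualMoment EK K μ p s = dualMoment EK K μ p (∑ i, b.repr s i • b i) := by rw [b.sum_repr]
      _ = _ := by rw [map_sum]; simp [mul_comm]
  rw [h]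
  refine contMDiff_finsetSum fun i _ => ?_
  exact ContMDiff.smul (hμ.smooth (b i)) contMDiff_const

end DualMoment

namespace LinearModel

variable {EK : Type*} [NormedAddCommGroup EK] [NormedSpace ℝ EK]
  {K : Type*} [Group K] [TopologicalSpace K] [ChartedSpace EK K]
  {EG : Type*} [NormedAddCommGroup EG] [NormedSpace ℂ EG]
  {G : Type*} [Group G] [TopologicalSpace G] [ChartedSpace EG G]
  {ι : K →* G} {A : Type*} [CStarAlgebra A] (D : LinearModel (EK := EK) (EG := EG) ι A)

section

variable {E : Type*} [NormedAddCommGroup E] [NormedSpace ℂ E]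
  {F : Type*} [TopologicalSpace F] [ChartedSpace E F]
  [MulAction K F] [MulAction G F] [ContMDiffSMul 𝓘(ℂ, EG) 𝓘(ℂ, E) ω G F]

lemma infinitesimalAction_eq (hGK : ∀ (k : K) (x : F), ι k • x = k • x) (s : EK) (p : F) :
    (infinitesimalAction (K := K) (E := E) (EK := EK) s p : E) = orbitDiff EG G E p (D.L s) := by
  have h : HasDiff (E' := E) (fun k : K => k • p) 1 ((orbitDiff EG G E p).comp D.L) :=
    ((hasDiff_orbit p).comp D.hasDiff_ι (map_one ι)).congr fun k => (hGK k p).symm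
  exact DFunLike.congr_fun h.mfderiv_eq s

variable [FiniteDimensional ℝ EK] {Ω : TwoForm E F}
  {μ : F → Module.Dual ℝ (TangentSpace 𝓘(ℝ, EK) (1 : K))}

lemma hasDiff_moment (hGK : ∀ (k : K) (x : F), ι k • x = k • x) (hμ : IsMomentMap Ω μ)
    (s : EK) (p : F) : ∃ f : E →L[ℝ] ℝ, HasDiff (fun y => dualMoment EK K μ y s) p f ∧
      ∀ v : E, f v = Ω p ![(orbitDiff EG G E p (D.L s) : E), v] := by
  obtain ⟨f, hf⟩ := (hμ.smooth s).exists_hasDiff (by simp) p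
  refine ⟨f, hf, fun v => ?_⟩
  rw [← D.infinitesimalAction_eq hGK]
  exact (DFunLike.congr_fun hf.mfderiv_eq v).symm.trans (hμ.hamiltonian s p v)

end

variable [FiniteDimensional ℝ EK] [CompleteSpace EG] [LieGroup 𝓘(ℝ, EG) ∞ G] [T2Space G]

variable {E : Type*} [NormedAddCommGroup E] [NormedSpace ℂ E]
  {F : Type*} [TopologicalSpace F] [ChartedSpace E F]
  [MulAction G F] [ContMDiffSMul 𝓘(ℂ, EG) 𝓘(ℂ, E) ω G F]

/-- If no nonzero vector of `𝔨` vanishes at `p`, then the stabiliser of `p` in `K` is discrete. -/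
lemma eventually_eq_zero (p : F) (h : ∀ b, orbitDiff EG G E p (D.L b) = 0 → b = 0) :
    ∀ᶠ a in 𝓝 (0 : EK), D.e (a, 0) • p = p → a = 0 := by
  obtain ⟨f, hf⟩ := D.contMDiff_e.exists_hasDiff (by simp) (0 : EK × EK)
  have hfΛ : f = D.Λ := by
    refine ContinuousLinearMap.ext fun q => ?_
    have h1 : HasVel (fun t : ℝ => t • q) 0 q :=
      hasVel_iff_hasDerivAt.2 (by simpa using (hasDerivAt_id (0 : ℝ)).smul_const q)
    exact (hf.comp_hasVel h1 (by simp)).unique (D.hasVel_e q)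
  have hi : HasDiff (fun a : EK => (a, (0 : EK))) 0 (ContinuousLinearMap.inl ℝ EK EK) :=
    hasDiff_iff_hasFDerivAt.2 (ContinuousLinearMap.inl ℝ EK EK).hasFDerivAt
  set f' : EK →L[ℝ] E := (orbitDiff EG G E p).comp D.L with hf'
  have hd : HasDiff (E' := E) (fun a : EK => D.e (a, 0) • p) 0 f' := by
    have h2 := (hasDiff_orbit (E := E) p).comp (hf.comp hi rfl) (by exact D.e_zero)
    have h3 : (orbitDiff EG G E p).comp (f.comp (ContinuousLinearMap.inl ℝ EK EK)) = f' := by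
      ext a
      simp [hfΛ, Λ_apply, hf']
    rwa [h3] at h2
  have hd2 : HasFDerivAt (fun a : EK => chartAt E p (D.e (a, 0) • p)) f' 0 := by
    have h4 := hd.2
    have h5 : D.e ((0 : EK), (0 : EK)) = 1 := D.e_zero
    rw [← hasFDerivWithinAt_univ]
    simp only [mfld_simps] at h4
    simp only [h5, one_smul] at h4
    exact h4
  obtain ⟨C, -, hC⟩ := LinearMap.exists_antilipschitzWith (f' : EK →ₗ[ℝ] E)
    (LinearMap.ker_eq_bot'.2 fun b hb => h b hb)
  have h6 := hd2.eventually_ne (c := chartAt E p p) ⟨C, hC⟩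
  rw [eventually_nhdsWithin_iff] at h6
  filter_upwards [h6] with a ha hap
  by_contra h0
  exact ha h0 (by rw [hap])

variable [LieGroup 𝓘(ℝ, EK) ∞ K] [T2Space K]

/-- The derivative of `Ad (exp (t a)) d` at `t = 0`, in the representation. -/
lemma hasDerivAt_T_Ad {γ : ℝ → K} {a : EK}
    (hγ : ∀ t : ℝ, ι (γ t) = D.e (t • a, 0)) (d : EK) :
    HasDerivAt (fun t => D.T (Ad (EK := EK) (γ t) d)) (D.T a * D.T d - D.T d * D.T a) 0 := by
  have h1 : ∀ t : ℝ, D.T (Ad (EK := EK) (γ t) d) =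
      exp (t • D.T a) * D.T d * exp (t • (-D.T a)) := fun t => by
    have h2 : D.ρ (ι (γ t)) = exp (t • D.T a) := by rw [hγ, ρ_e]; simp
    have h3 : D.ρ (ι (γ t)⁻¹) = exp (t • (-D.T a)) := by
      have h4 : D.ρ (ι (γ t)⁻¹) * exp (t • D.T a) = 1 := by
        rw [← h2, ← map_mul, ← map_mul]; simp
      calc _ = D.ρ (ι (γ t)⁻¹) * (exp (t • D.T a) * exp (-(t • D.T a))) := by
            rw [exp_mul_exp_neg, mul_one]
        _ = _ := by rw [← mul_assoc, h4, one_mul, smul_neg]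
    rw [D.T_Ad, h2, h3]
  have h5 := ((hasDerivAt_exp_smul (D.T a) 0).mul_const (D.T d)).mul
    (hasDerivAt_exp_smul (-D.T a) 0)
  refine (h5.congr_of_eventuallyEq (Filter.Eventually.of_forall h1)).congr_deriv ?_
  simp
  noncomm_ring

/-- `𝔨` is closed under brackets, since `T 𝔨` is closed in `A` and stable under `Ad K`. -/
lemma exists_bracket (a d : EK) : ∃ c, D.T c = D.T a * D.T d - D.T d * D.T a := by
  obtain ⟨γ, -, -, hγ⟩ := D.exists_oneParameter_K a
  have h1 := D.hasDerivAt_T_Ad hγ d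
  refine ⟨(D.π (D.T a * D.T d - D.T d * D.T a)).1, ?_⟩
  have h2 : HasDerivAt (fun t => D.T (D.π (D.T (Ad (EK := EK) (γ t) d))).1)
      (D.T (D.π (D.T a * D.T d - D.T d * D.T a)).1) 0 :=
    ((D.T.comp ((ContinuousLinearMap.fst ℝ EK EK).comp D.π)).hasFDerivAt.comp_hasDerivAt 0 h1)
  exact h2.unique (h1.congr_of_eventuallyEq
    (Filter.Eventually.of_forall fun t => D.T_fst_π_T (Ad (EK := EK) (γ t) d)))

lemma hasDerivAt_Ad {γ : ℝ → K} {a : EK}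
    (hγ : ∀ t : ℝ, ι (γ t) = D.e (t • a, 0)) {c d : EK}
    (hc : D.T c = D.T a * D.T d - D.T d * D.T a) :
    HasDerivAt (fun t => (Ad (EK := EK) (γ t) d : EK)) c 0 := by
  have h1 := D.hasDerivAt_T_Ad hγ d
  rw [← hc] at h1
  have h2 : HasDerivAt (fun t => (D.π (D.T (Ad (EK := EK) (γ t) d))).1) (D.π (D.T c)).1 0 :=
    (((ContinuousLinearMap.fst ℝ EK EK).comp D.π).hasFDerivAt.comp_hasDerivAt 0 h1)
  rw [fst_π_T] at h2
  exact h2.congr_of_eventuallyEq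
    (Filter.Eventually.of_forall fun t => (D.fst_π_T (Ad (EK := EK) (γ t) d)).symm)

variable [MulAction K F]
  {Ω : TwoForm E F} {μ : F → Module.Dual ℝ (TangentSpace 𝓘(ℝ, EK) (1 : K))}

/-- The infinitesimal form of the equivariance of the moment map, where `c = [a, d]`. -/
lemma form_orbitDiff_eq (hGK : ∀ (k : K) (x : F), ι k • x = k • x) (hμ : IsMomentMap Ω μ)
    {a c d : EK} (hc : D.T c = D.T a * D.T d - D.T d * D.T a) (p : F) :
    Ω p ![(orbitDiff EG G E p (D.L d) : E), (orbitDiff EG G E p (D.L a) : E)] =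
      -dualMoment EK K μ p c := by
  obtain ⟨γ, h0, hγ, hγe⟩ := D.exists_oneParameter_K a
  have hv : HasVel (E := E) (fun t => ι (γ t) • p) 0 (orbitDiff EG G E p (D.L a)) :=
    (hasDiff_orbit p).comp_hasVel (D.hasDiff_ι.comp_hasVel hγ h0) (by simp [h0])
  obtain ⟨f, hf⟩ := (contMDiff_dualMoment hμ).exists_hasDiff (by simp) p
  have h1 := hasVel_iff_hasDerivAt.1 (hf.comp_hasVel hv (by simp [h0]))
  obtain ⟨f', hf', hf''⟩ := D.hasDiff_moment hGK hμ d p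
  have h2 := hasVel_iff_hasDerivAt.1 (hf'.comp_hasVel hv (by simp [h0]))
  have h3 := (h1.clm_apply (hasDerivAt_const (0 : ℝ) d)).unique h2
  have h4 := h1.clm_apply (D.hasDerivAt_Ad hγe hc)
  have h5 : ∀ t, dualMoment EK K μ (ι (γ t) • p) (Ad (EK := EK) (γ t) d) =
      dualMoment EK K μ p d := fun t => by
    rw [hGK]; exact hμ.equivariant (γ t) p d
  have h6 := (h4.congr_of_eventuallyEq (f₁ := fun _ => dualMoment EK K μ p d)
    (Filter.Eventually.of_forall fun t => (h5 t).symm)).unique (hasDerivAt_const (0 : ℝ) _)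
  have h7 : (Ad (EK := EK) (γ 0) d : EK) = d := by
    have : D.T (Ad (EK := EK) (γ 0) d) = D.T d := by rw [D.T_Ad, h0]; simp
    rw [← D.fst_π_T (Ad (EK := EK) (γ 0) d), this, fst_π_T]
  rw [← hf'', ← h3]
  rw [h7] at h6
  simp only [h0, map_one, one_smul, map_zero, add_zero] at h6 ⊢
  linarith

/-- The derivative of the moment map along `t ↦ exp (𝐢 (s + t q)) y`. The velocity of this curve is
generated by `a + 𝐢 b`; the equation for `dμ` gives the metric on `𝐢 b`, and equivariance the
bracket with `a`. -/
lemma hasDerivAt_moment (hGK : ∀ (k : K) (x : F), ι k • x = k • x) (hμ : IsMomentMap Ω μ)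
    (y : F) (s q d : EK) {a b c : EK}
    (hab : D.polarData.B s q = D.polarData.T a + D.polarData.S b)
    (hc : D.T c = D.T a * D.T d - D.T d * D.T a) :
    HasDerivAt (fun t : ℝ => dualMoment EK K μ (D.e (0, s + t • q) • y) d)
      (Ω (D.e (0, s) • y) ![(orbitDiff EG G E (D.e (0, s) • y) (D.L d) : E),
          (Complex.I • orbitDiff EG G E (D.e (0, s) • y) (D.L b) : E)] -
        dualMoment EK K μ (D.e (0, s) • y) c) 0 := by
  set p := D.e (0, s) • y with hp
  obtain ⟨a', b', hv, h⟩ := D.exists_hasVel_E s q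
  have h1 : D.T a' + Complex.I • D.T b' = D.T a + Complex.I • D.T b := h.symm.trans hab
  have h2 := congrArg D.π h1
  rw [← D.dρ_Λ (a', b'), ← D.dρ_Λ (a, b), π_dρ_Λ, π_dρ_Λ] at h2
  rw [h2] at hv
  obtain ⟨f, hf, hf'⟩ := D.hasDiff_moment hGK hμ d p
  have h3 : HasVel (E := E) (fun t : ℝ => D.e (0, s + t • q) • y) 0
      (orbitDiff EG G E p (D.Λ (a, b))) :=
    ((hasDiff_orbit p).comp_hasVel hv (by simp)).congr fun t => by
      rw [hp, smul_smul, inv_mul_cancel_right]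
  have h4 := hasVel_iff_hasDerivAt.1 (hf.comp_hasVel h3 (by simp [hp]))
  refine h4.congr_deriv ?_
  rw [Λ_apply, map_add, orbitDiff_I_smul, map_add, hf', hf', D.form_orbitDiff_eq hGK hμ hc]
  ring

/-- Moment data for the action of a linear complexification on a Kähler manifold. The Gram form at
`p` is that of the Kähler metric on the vectors generated by `𝔨` at `p`. -/
noncomputable def momentData [IsManifold 𝓘(ℝ, E) 1 F] [T2Space F]
    (hGK : ∀ (k : K) (x : F), ι k • x = k • x) (hΩ : IsKahlerForm Ω) (hμ : IsMomentMap Ω μ) :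
    MomentData D.polarData F where
  m := dualMoment EK K μ
  gp p b d := Ω p ![(orbitDiff EG G E p (D.L b) : E),
    complexStructure p (orbitDiff EG G E p (D.L d))]
  gp_symm p b d := hΩ.symm p _ _
  gp_nonneg p b := hΩ.nonneg p _
  E_smul_eq p b h t := by
    have h1 : orbitDiff EG G E p (D.Λ (0, b)) = 0 := by
      rw [Λ_apply, map_add, orbitDiff_I_smul, show orbitDiff EG G E p (D.L b) = 0 from hΩ.eq_zero h]
      simp
    have h2 := smul_eq_of_orbitDiff_eq_zero (γ := fun t : ℝ => D.e (t • (0, b))) (by simp [e_zero])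
      (D.e_add_smul (0, b)) (D.hasVel_e (0, b)) h1 t
    have h3 : D.e (0, t • b) • p = p := by simpa using h2
    exact h3
  eventually_eq_zero p h := D.eventually_eq_zero p fun b hb => by
    by_contra h0
    refine h b h0 ?_
    rw [hb]
    exact Ω.apply_zero_left p _
  equivariant k p s := by
    rw [show (D.polarData.ι k) • p = k • p from hGK k p]
    exact hμ.equivariant k p s
  contDiff y := by
    have h1 : ContMDiff 𝓘(ℝ, EK) 𝓘(ℝ, E) 1 fun s => D.e (0, s) • y :=
      (((contMDiff_real_of_complex (contMDiff_smul_const (EG := EG) (E := E) y)).of_le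
        (by simp)).comp D.contMDiff_e).comp
        (ContDiff.contMDiff (by fun_prop : ContDiff ℝ 1 fun s : EK => ((0 : EK), s)))
    exact (((contMDiff_dualMoment hμ).of_le (by simp)).comp h1).contDiff
  exists_bracket := D.exists_bracket
  hasDerivAt y s q d a b c hab hc := by
    have := D.hasDerivAt_moment hGK hμ y s q d hab hc
    refine this.congr_deriv ?_
    congr 1
    exact hΩ.symm _ _ _

end LinearModel

/-! ### The linear model of a complexification -/

section Model

variable {EK : Type*} [NormedAddCommGroup EK] [NormedSpace ℝ EK]
  {K : Type*} [Group K] [TopologicalSpace K] [ChartedSpace EK K]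
  {EG : Type*} [NormedAddCommGroup EG] [NormedSpace ℂ EG] [FiniteDimensional ℂ EG]
  {G : Type*} [Group G] [TopologicalSpace G] [ChartedSpace EG G] [LieGroup 𝓘(ℂ, EG) ω G]
  [T2Space G] {ι : K →* G}

/-- A linear map of a finite-dimensional Hilbert space that preserves the norm is an isometry in the
sense of `C⋆`-algebras. -/
lemma star_mul_self_of_norm_map {H : Type*} [NormedAddCommGroup H] [InnerProductSpace ℂ H]
    [CompleteSpace H] {u : H →L[ℂ] H} (h : ∀ w, ‖u w‖ = ‖w‖) : star u * u = 1 :=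
  (ContinuousLinearMap.norm_map_iff_adjoint_comp_self u).1 h

/-- The differential of a faithful representation is injective, and `𝔨 × 𝔨 ≃ 𝔤`, so that
`(a, b) ↦ dρ (a + 𝐢 b)` has a left inverse. -/
lemma IsComplexification.exists_linearModel (hι : IsComplexification (EK := EK) (EG := EG) ι) :
    ∃ n : ℕ, Nonempty (LinearModel (EK := EK) (EG := EG) ι
      (EuclideanSpace ℂ (Fin n) →L[ℂ] EuclideanSpace ℂ (Fin n))) := by
  have : LieGroup 𝓘(ℝ, EG) ω G := lieGroup_real_of_complex
  have : LieGroup 𝓘(ℝ, EG) ∞ G := LieGroup.of_le (n := ω) le_top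
  have : CompleteSpace EG := FiniteDimensional.complete ℂ EG
  obtain ⟨n, ρ, hρ, hinj, hnorm⟩ := hι.linear
  refine ⟨n, ?_⟩
  obtain ⟨dρ, hdρ⟩ := exists_hasDiff_of_complex (hρ.mdifferentiable (by simp) 1)
  obtain ⟨L, hL⟩ := hι.smooth.exists_hasDiff (by simp) 1
  have hbij : Function.Bijective fun p : EK × EK => L p.1 + Complex.I • L p.2 := by
    have h1 : ∀ s : EK, (lieMap (EK := EK) (EG := EG) ι s : EG) = L s :=
      fun s => DFunLike.congr_fun hL.mfderiv_eq s
    have h2 : (fun p : EK × EK => L p.1 + Complex.I • L p.2) = fun p : EK × EK =>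
        (lieMap (EK := EK) (EG := EG) ι p.1 +
          complexStructure (1 : G) (lieMap (EK := EK) (EG := EG) ι p.2) :
            TangentSpace 𝓘(ℝ, EG) (1 : G)) :=
      funext fun p =>
        congrArg₂ (fun a b : EG => a + Complex.I • b) (h1 p.1).symm (h1 p.2).symm
    rw [h2]
    exact hι.lieAlgebra
  have hdinj := injective_of_injective_ρ (ρ := ρ) hdρ hinj
  let Λ : EK × EK →ₗ[ℝ] (EuclideanSpace ℂ (Fin n) →L[ℂ] EuclideanSpace ℂ (Fin n)) :=
    ((dρ.restrictScalars ℝ).comp (L.comp (ContinuousLinearMap.fst ℝ EK EK) +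
      (Complex.I • L).comp (ContinuousLinearMap.snd ℝ EK EK))).toLinearMap
  obtain ⟨π, hπ⟩ := Λ.exists_leftInverse_of_injective
    (LinearMap.ker_eq_bot.2 (hdinj.comp hbij.1))
  exact ⟨{
    ρ := ρ
    dρ := dρ
    L := L
    π := LinearMap.toContinuousLinearMap π
    injective_ρ := hinj
    contMDiff_ρ := (contMDiff_real_of_complex hρ).of_le le_top
    hasDiff_ρ := hdρ
    continuous_ι := hι.smooth.continuous
    hasDiff_ι := hL
    exists_eq := fun w => by
      obtain ⟨p, hp⟩ := hbij.2 w
      exact ⟨p.1, p.2, hp.symm⟩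
    π_dρ := fun a b => DFunLike.congr_fun hπ (a, b)
    star_ρ_ι := fun k => star_mul_self_of_norm_map (hnorm k) }⟩

end Model

lemma LinearModel.weight_eq {EK : Type*} [NormedAddCommGroup EK] [NormedSpace ℝ EK]
    {K : Type*} [Group K] [TopologicalSpace K] [ChartedSpace EK K]
    {EG : Type*} [NormedAddCommGroup EG] [NormedSpace ℂ EG]
    {G : Type*} [Group G] [TopologicalSpace G] [ChartedSpace EG G]
    {ι : K →* G} {A : Type*} [CStarAlgebra A] (D : LinearModel (EK := EK) (EG := EG) ι A)
    {F : Type*} [MulAction G F] (μ : F → Module.Dual ℝ (TangentSpace 𝓘(ℝ, EK) (1 : K)))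
    (x : F) (s : EK) (t : ℝ) :
    weight EG ι μ x s t = μ (D.e (0, t • s) • x) s := by
  have h1 : (lieMap (EK := EK) (EG := EG) ι s : EG) = D.L s :=
    DFunLike.congr_fun D.hasDiff_ι.mfderiv_eq s
  have h2 : (t • complexStructure (1 : G) (lieMap (EK := EK) (EG := EG) ι s) :
      TangentSpace 𝓘(ℝ, EG) (1 : G)) = D.Λ (0, t • s) :=
    (congrArg (fun a : EG => t • (Complex.I • a)) h1).trans (by
      rw [D.Λ_apply, map_zero, zero_add, map_smul, smul_comm])
  exact congrArg (fun v : EG => μ (lieExp (E := EG) (G := G) v • x) s) h2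

end KempfNess

theorem mainTheorem7
    {EK : Type*} [NormedAddCommGroup EK] [NormedSpace ℝ EK] [FiniteDimensional ℝ EK]
    {K : Type*} [Group K] [TopologicalSpace K] [ChartedSpace EK K] [LieGroup 𝓘(ℝ, EK) ∞ K]
    [T2Space K] [CompactSpace K] [ConnectedSpace K]
    {EG : Type*} [NormedAddCommGroup EG] [NormedSpace ℂ EG] [FiniteDimensional ℂ EG]
    {G : Type*} [Group G] [TopologicalSpace G] [ChartedSpace EG G] [LieGroup 𝓘(ℂ, EG) ω G]
    [T2Space G]
    (ι : K →* G) (hι : KempfNess.IsComplexification (EK := EK) (EG := EG) ι)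
    {E : Type*} [NormedAddCommGroup E] [NormedSpace ℂ E] [FiniteDimensional ℂ E]
    {F : Type*} [TopologicalSpace F] [ChartedSpace E F] [IsManifold 𝓘(ℂ, E) ω F] [T2Space F]
    (Ω : KempfNess.TwoForm E F) (hΩ : KempfNess.IsKahlerForm Ω)
    [MulAction K F] (hK : Ω.IsInvariant K)
    [MulAction G F] [ContMDiffSMul 𝓘(ℂ, EG) 𝓘(ℂ, E) ω G F]
    (hGK : ∀ (k : K) (x : F), ι k • x = k • x)
    (μ : F → Module.Dual ℝ (TangentSpace 𝓘(ℝ, EK) (1 : K)))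
    (hμ : KempfNess.IsMomentMap Ω μ) (x : F) :
    (∀ y ∈ MulAction.orbit G x, ∀ z ∈ MulAction.orbit G x,
      (∀ y' ∈ MulAction.orbit K y, μ y' = 0) → (∀ z' ∈ MulAction.orbit K z, μ z' = 0) →
        MulAction.orbit K y = MulAction.orbit K z) ∧
    (∀ s : TangentSpace 𝓘(ℝ, EK) (1 : K), Filter.Tendsto
      (fun t : ℝ => (KempfNess.weight EG ι μ x s t : EReal)) Filter.atTop
        (𝓝 (KempfNess.maximalWeight EG ι μ x s))) ∧
    (KempfNess.AnalyticallyStable EG ι μ x ↔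
      (MulAction.stabilizer G x : Set G).Finite ∧
        ∃ y ∈ MulAction.orbit G x, ∀ y' ∈ MulAction.orbit K y, μ y' = 0) := by
  have : LieGroup 𝓘(ℝ, EG) ω G := KempfNess.lieGroup_real_of_complex
  have : LieGroup 𝓘(ℝ, EG) ∞ G := LieGroup.of_le (n := ω) le_top
  have : IsManifold 𝓘(ℝ, E) ω F := KempfNess.isManifold_real_of_complex
  have : IsManifold 𝓘(ℝ, E) 1 F := IsManifold.of_le (n := ω) le_top
  have : CompleteSpace EG := FiniteDimensional.complete ℂ EG
  have : CompleteSpace EK := FiniteDimensional.complete ℝ EK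
  have : ConnectedSpace G := hι.connected
  have : IsTopologicalGroup G := topologicalGroup_of_lieGroup 𝓘(ℂ, EG) ω
  have : ContinuousSMul G F := ContMDiffSMul.continuousSMul (I := 𝓘(ℂ, EG)) (I' := 𝓘(ℂ, E)) ω
  obtain ⟨n, ⟨D⟩⟩ := hι.exists_linearModel
  set M := D.momentData hGK hΩ hμ with hM
  have hw : ∀ s : EK, KempfNess.weight EG ι μ x s = M.w x s := fun s => funext fun t =>
    D.weight_eq μ x s t
  have hm : ∀ y, M.m y = 0 ↔ μ y = 0 := fun y =>
    LinearEquiv.map_eq_zero_iff (LinearMap.toContinuousLinearMap (𝕜 := ℝ) (E := EK) (F' := ℝ))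
  have horb : ∀ y, M.m y = 0 → ∀ y' ∈ MulAction.orbit K y, μ y' = 0 := by
    rintro y hy _ ⟨k, rfl⟩
    rw [← hm]
    refine M.m_eq_zero_of_ι_smul (k := k⁻¹) ?_
    have h1 : D.polarData.ι k⁻¹ • k • y = y := (hGK k⁻¹ (k • y)).trans (inv_smul_smul k y)
    exact (congrArg M.m h1).trans hy
  have hzero : ∀ y, (∀ y' ∈ MulAction.orbit K y, μ y' = 0) → M.m y = 0 := fun y hy =>
    (hm y).2 (hy y (MulAction.mem_orbit_self y))
  -- the weights are monotone in `t`, so that the maximal weight is their supremum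
  have hlim : ∀ s : EK, Filter.Tendsto
      (fun t : ℝ => (KempfNess.weight EG ι μ x s t : EReal)) Filter.atTop
      (𝓝 (⨆ t, (M.w x s t : EReal))) := fun s => by
    rw [hw s]
    exact tendsto_atTop_iSup fun t t' h => EReal.coe_le_coe_iff.2 (M.monotone_w x s h)
  have hmax : ∀ s : EK, KempfNess.maximalWeight EG ι μ x s = ⨆ t, (M.w x s t : EReal) := fun s =>
    (hlim s).limUnder_eq
  -- since `0 < λ` for the supremum `λ` if and only if some weight is positive
  have hstable : KempfNess.AnalyticallyStable EG ι μ x ↔ M.Positive x := by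
    refine forall_congr' fun s => imp_congr_right fun _ => ?_
    rw [hmax s, lt_iSup_iff]
    exact exists_congr fun t => EReal.coe_pos
  refine ⟨?_, fun s => ?_, ?_⟩
  · rintro y hy z hz hy0 hz0
    obtain ⟨g, rfl⟩ : ∃ g : G, g • y = z := by
      rw [← MulAction.orbit_eq_iff.2 hy] at hz
      exact hz
    obtain ⟨k, s, rfl⟩ := D.polarData.exists_polar g
    -- `g = k exp (𝐢 s)`, and `exp (𝐢 s)` fixes `y`
    have h1 := (M.E_smul_of_m_eq_zero (hzero _ hy0) (hzero _ hz0)).2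
    have h2 : (D.polarData.ι k * D.polarData.E s) • y = k • y := by
      rw [mul_smul, h1]
      exact hGK k y
    rw [h2, MulAction.orbit_smul]
  · rw [hmax s]
    exact hlim s
  · rw [hstable]
    constructor
    · intro hx
      obtain ⟨s, hs⟩ := hx.exists_zero M
      refine ⟨?_, D.polarData.E s • x, ⟨_, rfl⟩, horb _ hs⟩
      have h1 := (hx.smul M (D.polarData.E s)).finite_stabilizer M hs
      rw [MulAction.stabilizer_smul_eq_stabilizer_map_conj, Subgroup.coe_map] at h1
      exact h1.of_finite_image (MulEquiv.injective _).injOn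
    · rintro ⟨hfin, y, ⟨g, rfl⟩, hy⟩
      have h1 : (MulAction.stabilizer G (g • x) : Set G).Finite := by
        rw [MulAction.stabilizer_smul_eq_stabilizer_map_conj, Subgroup.coe_map]
        exact hfin.image _
      have h2 := (M.positive_of_finite_stabilizer (hzero _ hy) h1).smul M g⁻¹
      rwa [inv_smul_smul] at h2
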